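/- Let $M$ be a smooth $n$-manifold (without boundary), $I\subset\mathbb R$ an interval with more than one point, $(g_t)_{t\in I}$ a smooth family of Riemannian metrics and $(b_t)_{t\in I}$ a smooth family of two-forms on $M$, $H_0$ a fixed smooth closed three-form on $M$, and $H_t=H_0+db_t$. Time derivatives at end points of $I$ are one-sided. For each $t$ let $D$ be the Levi-Civita connection of $g_t$ and $\nabla=D+\tfrac12 g_t^{-1}H_t$ the Bismut connection, i.e. $g_t(\nabla_XY,Z)=g_t(D_XY,Z)+\tfrac12H_t(X,Y,Z)$. Let $\Delta=\operatorname{tr}_{g_t}\nabla\nabla$ be its Laplacian, acting on functions and on vector fields, and let $\mathrm{Rc}^\nabla(Y,Z)=\operatorname{tr}\big(X\mapsto R^\nabla(X,Y)Z\big)$ be its Ricci tensor, where $R^\nabla(X,Y)Z=\nabla_X\nabla_YZ-\nabla_Y\nabla_XZ-\nabla_{[X,Y]}Z$. For a time-dependent vector field $Y$ put $$\nabla_tY=\partial_tY+\tfrac12\,\partial_t(g_t+b_t)(Y,\cdot)^{\sharp_{g_t}},$$ where $A(Y,\cdot)^{\sharp_{g_t}}$ is the vector field with $g_t\big(A(Y,\cdot)^{\sharp_{g_t}},Z\big)=A(Y,Z)$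 for all $Z$. **Proposition 3.4.** Let $u$ be a smooth function on $M\times I$ with $\partial_tu=\Delta u$. Then, on $M\times I$, $$\nabla_t\,\mathrm{grad}_{g_t}u=\Delta\,\mathrm{grad}_{g_t}u-\Big(\mathrm{Rc}^\nabla+\tfrac12\,\partial_t(g_t-b_t)\Big)\big(\mathrm{grad}_{g_t}u,\cdot\big)^{\sharp_{g_t}}.$$ Consequently, if $(g_t,b_t)$ solves generalized Ricci flow, that is $$\partial_tg=-2\,\mathrm{Rc}+\tfrac12H^2,\qquad \partial_tb=-d^*_gH,\qquad H=H_0+db,$$ where $\mathrm{Rc}$ is the Ricci tensor of $D$, $(H^2)_{ij}=g^{kp}g^{lq}H_{ikl}H_{jpq}$ and $(d^*_gH)_{ij}=-g^{kl}(D_kH)_{lij}$, then $\nabla_t\,\mathrm{grad}_{g_t}u=\Delta\,\mathrm{grad}_{g_t}u$. -/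

import Mathlib

open Set
open scoped Manifold ContDiff

noncomputable section

namespace GenRicci

/-! ## Tensor calculus in a coordinate domain

All tensors below are given by their components, as functions of the coordinates
`z : EuclideanSpace ℝ (Fin n)`. -/

section Coordinates

variable {n : ℕ}

/-- The `i`-th coordinate direction. -/
def basisVec (i : Fin n) : EuclideanSpace ℝ (Fin n) := EuclideanSpace.single i 1

/-- The partial derivative `∂_i f` at `z`. -/
def pd (i : Fin n) (f : EuclideanSpace ℝ (Fin n) → ℝ) (z : EuclideanSpace ℝ (Fin n)) : ℝ :=
  fderiv ℝ f z (basisVec i)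

/-- The Christoffel symbols `Γ i j k = Γ_{ij}^k` of the Levi-Civita connection `D` of the metric
with matrix `G`, that is `D_{∂_i} ∂_j = Γ_{ij}^k ∂_k`. -/
def leviCivita (G : EuclideanSpace ℝ (Fin n) → Matrix (Fin n) (Fin n) ℝ)
    (z : EuclideanSpace ℝ (Fin n)) (i j k : Fin n) : ℝ :=
  (1 / 2) * ∑ l, (pd i (fun y => G y j l) z + pd j (fun y => G y i l) z
    - pd l (fun y => G y i j) z) * (G z)⁻¹ l k

/-- The coefficients `Γ_{ij}^k` of the Bismut connection `∇ = D + ½ g⁻¹ H`, that is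
`g (∇_X Y, Z) = g (D_X Y, Z) + ½ H (X, Y, Z)`. -/
def bismut (G : EuclideanSpace ℝ (Fin n) → Matrix (Fin n) (Fin n) ℝ)
    (H : EuclideanSpace ℝ (Fin n) → Fin n → Fin n → Fin n → ℝ)
    (z : EuclideanSpace ℝ (Fin n)) (i j k : Fin n) : ℝ :=
  leviCivita G z i j k + (1 / 2) * ∑ l, H z i j l * (G z)⁻¹ l k

/-- The covariant derivative `(∇_i α)_j` of a one-form `α`. -/
def covOneForm (Γ : EuclideanSpace ℝ (Fin n) → Fin n → Fin n → Fin n → ℝ)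
    (α : EuclideanSpace ℝ (Fin n) → Fin n → ℝ) (z : EuclideanSpace ℝ (Fin n))
    (i j : Fin n) : ℝ :=
  pd i (fun y => α y j) z - ∑ l, Γ z i j l * α z l

/-- The covariant derivative `(∇_i V)^k` of a vector field `V`. -/
def covVec (Γ : EuclideanSpace ℝ (Fin n) → Fin n → Fin n → Fin n → ℝ)
    (V : EuclideanSpace ℝ (Fin n) → Fin n → ℝ) (z : EuclideanSpace ℝ (Fin n))
    (i k : Fin n) : ℝ :=
  pd i (fun y => V y k) z + ∑ l, Γ z i l k * V z l

/-- The covariant derivative `(∇_i W)_j^k` of a tensor `W_j^k` of type `(1, 1)`. -/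
def covEnd (Γ : EuclideanSpace ℝ (Fin n) → Fin n → Fin n → Fin n → ℝ)
    (W : EuclideanSpace ℝ (Fin n) → Fin n → Fin n → ℝ) (z : EuclideanSpace ℝ (Fin n))
    (i j k : Fin n) : ℝ :=
  pd i (fun y => W y j k) z - ∑ l, Γ z i j l * W z l k + ∑ l, Γ z i l k * W z j l

/-- The covariant derivative `(∇_i H)_{jkl}` of a covariant tensor `H_{jkl}`. -/
def covThree (Γ : EuclideanSpace ℝ (Fin n) → Fin n → Fin n → Fin n → ℝ)
    (H : EuclideanSpace ℝ (Fin n) → Fin n → Fin n → Fin n → ℝ)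
    (z : EuclideanSpace ℝ (Fin n)) (i j k l : Fin n) : ℝ :=
  pd i (fun y => H y j k l) z - ∑ m, Γ z i j m * H z m k l - ∑ m, Γ z i k m * H z j m l
    - ∑ m, Γ z i l m * H z j k m

/-- The Laplacian `Δ f = tr_g ∇∇f` of a function, for the connection with coefficients `Γ`. -/
def lapFun (G : EuclideanSpace ℝ (Fin n) → Matrix (Fin n) (Fin n) ℝ)
    (Γ : EuclideanSpace ℝ (Fin n) → Fin n → Fin n → Fin n → ℝ)
    (f : EuclideanSpace ℝ (Fin n) → ℝ) (z : EuclideanSpace ℝ (Fin n)) : ℝ :=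
  ∑ i, ∑ j, (G z)⁻¹ i j * covOneForm Γ (fun y l => pd l f y) z i j

/-- The Laplacian `Δ V = tr_g ∇∇V` of a vector field, for the connection with coefficients `Γ`. -/
def lapVec (G : EuclideanSpace ℝ (Fin n) → Matrix (Fin n) (Fin n) ℝ)
    (Γ : EuclideanSpace ℝ (Fin n) → Fin n → Fin n → Fin n → ℝ)
    (V : EuclideanSpace ℝ (Fin n) → Fin n → ℝ) (z : EuclideanSpace ℝ (Fin n))
    (k : Fin n) : ℝ :=
  ∑ i, ∑ j, (G z)⁻¹ i j * covEnd Γ (covVec Γ V) z i j k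

/-- The curvature `R_{ijk}^l`, that is `R(∂_i, ∂_j) ∂_k = R_{ijk}^l ∂_l` with
`R(X, Y) Z = ∇_X ∇_Y Z - ∇_Y ∇_X Z - ∇_{[X, Y]} Z`. -/
def curvature (Γ : EuclideanSpace ℝ (Fin n) → Fin n → Fin n → Fin n → ℝ)
    (z : EuclideanSpace ℝ (Fin n)) (i j k l : Fin n) : ℝ :=
  pd i (fun y => Γ y j k l) z - pd j (fun y => Γ y i k l) z
    + ∑ p, (Γ z i p l * Γ z j k p - Γ z j p l * Γ z i k p)

/-- The Ricci tensor `Rc (Y, Z) = tr (X ↦ R(X, Y) Z)`. It need not be symmetric. -/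
def ricci (Γ : EuclideanSpace ℝ (Fin n) → Fin n → Fin n → Fin n → ℝ)
    (z : EuclideanSpace ℝ (Fin n)) (j k : Fin n) : ℝ :=
  ∑ i, curvature Γ z i j k i

/-- `H² (X, Y) = ⟨X ⌟ H, Y ⌟ H⟩`, that is `(H²)_{ij} = g^{kp} g^{lq} H_{ikl} H_{jpq}`. -/
def formSq (G : EuclideanSpace ℝ (Fin n) → Matrix (Fin n) (Fin n) ℝ)
    (H : EuclideanSpace ℝ (Fin n) → Fin n → Fin n → Fin n → ℝ)
    (z : EuclideanSpace ℝ (Fin n)) (i j : Fin n) : ℝ :=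
  ∑ k, ∑ l, ∑ p, ∑ q, (G z)⁻¹ k p * (G z)⁻¹ l q * H z i k l * H z j p q

/-- The codifferential `(d^* H)_{ij} = - g^{kl} (D_k H)_{lij}` of a three-form. -/
def codiff (G : EuclideanSpace ℝ (Fin n) → Matrix (Fin n) (Fin n) ℝ)
    (H : EuclideanSpace ℝ (Fin n) → Fin n → Fin n → Fin n → ℝ)
    (z : EuclideanSpace ℝ (Fin n)) (i j : Fin n) : ℝ :=
  - ∑ k, ∑ l, (G z)⁻¹ k l * covThree (leviCivita G) H z k l i j

/-- The vector `A (Y, ·)^♯`, with components `A_{ij} Y^i g^{jk}`, at a point where the metric has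
the matrix `G`. -/
def contractSharp (G A : Matrix (Fin n) (Fin n) ℝ) (Y : Fin n → ℝ) (k : Fin n) : ℝ :=
  ∑ i, ∑ j, A i j * Y i * G⁻¹ j k

/-- The gradient `(grad f)^k = g^{kj} ∂_j f`. -/
def gradVec (G : EuclideanSpace ℝ (Fin n) → Matrix (Fin n) (Fin n) ℝ)
    (f : EuclideanSpace ℝ (Fin n) → ℝ) (z : EuclideanSpace ℝ (Fin n)) (k : Fin n) : ℝ :=
  ∑ j, (G z)⁻¹ k j * pd j f z

end Coordinates

/-! ## Tensors on a manifold, read in a chart -/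

section Charts

variable {n : ℕ} {M : Type*} [TopologicalSpace M] [ChartedSpace (EuclideanSpace ℝ (Fin n)) M]

/-- The differential at `z` of the inverse of the chart `φ`; it sends the `i`-th basis vector to
the coordinate vector `∂_i`. -/
def chartFrame (φ : OpenPartialHomeomorph M (EuclideanSpace ℝ (Fin n)))
    (z : EuclideanSpace ℝ (Fin n)) :
    EuclideanSpace ℝ (Fin n) →L[ℝ] TangentSpace (𝓡 n) (φ.symm z) :=
  mfderiv (𝓡 n) (𝓡 n) φ.symm z

/-- The matrix `g_{ij} = g (∂_i, ∂_j)` of a field of bilinear forms in the chart `φ`. -/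
def metricInChart (φ : OpenPartialHomeomorph M (EuclideanSpace ℝ (Fin n)))
    (g : (x : M) → TangentSpace (𝓡 n) x →L[ℝ] TangentSpace (𝓡 n) x →L[ℝ] ℝ)
    (z : EuclideanSpace ℝ (Fin n)) : Matrix (Fin n) (Fin n) ℝ :=
  Matrix.of fun i j =>
    g (φ.symm z) (chartFrame φ z (basisVec i)) (chartFrame φ z (basisVec j))

/-- A differential `k`-form read in the chart `φ`: its pullback under the inverse of `φ`. -/
def formInChart {k : ℕ} (φ : OpenPartialHomeomorph M (EuclideanSpace ℝ (Fin n)))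
    (η : (x : M) → TangentSpace (𝓡 n) x [⋀^Fin k]→L[ℝ] ℝ) (z : EuclideanSpace ℝ (Fin n)) :
    EuclideanSpace ℝ (Fin n) [⋀^Fin k]→L[ℝ] ℝ :=
  (η (φ.symm z)).compContinuousLinearMap (chartFrame φ z)

end Charts

/-- A smooth one-parameter family `(g_t, b_t)`, `t ∈ I`, of Riemannian metrics and two-forms on the
smooth manifold `M`, together with a fixed closed background three-form `H₀`. Smoothness is joint
in time and space. -/
structure MetricFormFamily (n : ℕ) (M : Type*) [TopologicalSpace M]
    [ChartedSpace (EuclideanSpace ℝ (Fin n)) M] (I : Set ℝ) where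
  /-- the metrics `g_t` -/
  g : ℝ → (x : M) → TangentSpace (𝓡 n) x →L[ℝ] TangentSpace (𝓡 n) x →L[ℝ] ℝ
  /-- the two-forms `b_t` -/
  b : ℝ → (x : M) → TangentSpace (𝓡 n) x [⋀^Fin 2]→L[ℝ] ℝ
  /-- the background three-form -/
  H₀ : (x : M) → TangentSpace (𝓡 n) x [⋀^Fin 3]→L[ℝ] ℝ
  g_symm : ∀ t ∈ I, ∀ (x : M) (v w : TangentSpace (𝓡 n) x), g t x v w = g t x w v
  g_pos : ∀ t ∈ I, ∀ (x : M) (v : TangentSpace (𝓡 n) x), v ≠ 0 → 0 < g t x v v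
  g_smooth : ∀ φ ∈ IsManifold.maximalAtlas (𝓡 n) ∞ M, ∀ i j : Fin n,
    ContDiffOn ℝ ∞ (fun p : ℝ × EuclideanSpace ℝ (Fin n) => metricInChart φ (g p.1) p.2 i j)
      (I ×ˢ φ.target)
  b_smooth : ∀ φ ∈ IsManifold.maximalAtlas (𝓡 n) ∞ M,
    ContDiffOn ℝ ∞ (fun p : ℝ × EuclideanSpace ℝ (Fin n) => formInChart φ (b p.1) p.2)
      (I ×ˢ φ.target)
  H₀_smooth : ∀ φ ∈ IsManifold.maximalAtlas (𝓡 n) ∞ M,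
    ContDiffOn ℝ ∞ (formInChart φ H₀) φ.target
  H₀_closed : ∀ φ ∈ IsManifold.maximalAtlas (𝓡 n) ∞ M, ∀ z ∈ φ.target,
    extDeriv (formInChart φ H₀) z = 0

namespace MetricFormFamily

variable {n : ℕ} {M : Type*} [TopologicalSpace M] [ChartedSpace (EuclideanSpace ℝ (Fin n)) M]
  {I : Set ℝ}

/-- The matrix of `g_t` in the chart `φ`. -/
def G (F : MetricFormFamily n M I) (φ : OpenPartialHomeomorph M (EuclideanSpace ℝ (Fin n)))
    (t : ℝ) : EuclideanSpace ℝ (Fin n) → Matrix (Fin n) (Fin n) ℝ :=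
  metricInChart φ (F.g t)

/-- The components `b_{ij}` of `b_t` in the chart `φ`. -/
def B (F : MetricFormFamily n M I) (φ : OpenPartialHomeomorph M (EuclideanSpace ℝ (Fin n)))
    (t : ℝ) (z : EuclideanSpace ℝ (Fin n)) : Matrix (Fin n) (Fin n) ℝ :=
  Matrix.of fun i j => formInChart φ (F.b t) z ![basisVec i, basisVec j]

/-- The components `H_{ijk}` of `H_t = H₀ + d b_t` in the chart `φ`. -/
def H (F : MetricFormFamily n M I) (φ : OpenPartialHomeomorph M (EuclideanSpace ℝ (Fin n)))
    (t : ℝ) (z : EuclideanSpace ℝ (Fin n)) (i j k : Fin n) : ℝ :=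
  (formInChart φ F.H₀ z + extDeriv (formInChart φ (F.b t)) z)
    ![basisVec i, basisVec j, basisVec k]

/-- The coefficients in the chart `φ` of the Bismut connection of `(g_t, H_t)`. -/
def Γ (F : MetricFormFamily n M I) (φ : OpenPartialHomeomorph M (EuclideanSpace ℝ (Fin n)))
    (t : ℝ) : EuclideanSpace ℝ (Fin n) → Fin n → Fin n → Fin n → ℝ :=
  bismut (F.G φ t) (F.H φ t)

/-- The components of `∂_t g_t`. The time derivative is one-sided at an end point of `I`. -/
def dtG (F : MetricFormFamily n M I) (φ : OpenPartialHomeomorph M (EuclideanSpace ℝ (Fin n)))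
    (t : ℝ) (z : EuclideanSpace ℝ (Fin n)) : Matrix (Fin n) (Fin n) ℝ :=
  Matrix.of fun i j => derivWithin (fun s => F.G φ s z i j) I t

/-- The components of `∂_t b_t`. -/
def dtB (F : MetricFormFamily n M I) (φ : OpenPartialHomeomorph M (EuclideanSpace ℝ (Fin n)))
    (t : ℝ) (z : EuclideanSpace ℝ (Fin n)) : Matrix (Fin n) (Fin n) ℝ :=
  Matrix.of fun i j => derivWithin (fun s => F.B φ s z i j) I t

/-- The matrix of the Ricci tensor `Rc^∇` of the Bismut connection of `(g_t, H_t)`. -/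
def ricciBismut (F : MetricFormFamily n M I)
    (φ : OpenPartialHomeomorph M (EuclideanSpace ℝ (Fin n))) (t : ℝ)
    (z : EuclideanSpace ℝ (Fin n)) : Matrix (Fin n) (Fin n) ℝ :=
  Matrix.of fun i j => ricci (F.Γ φ t) z i j

/-- The twisted spacetime connection in the direction of time,
`∇_t Y = ∂_t Y + ½ ∂_t (g_t + b_t) (Y, ·)^♯`, applied to a time-dependent vector field with
components `Y` in the chart `φ`. -/
def nablaT (F : MetricFormFamily n M I)
    (φ : OpenPartialHomeomorph M (EuclideanSpace ℝ (Fin n)))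
    (Y : ℝ → EuclideanSpace ℝ (Fin n) → Fin n → ℝ) (t : ℝ) (z : EuclideanSpace ℝ (Fin n))
    (k : Fin n) : ℝ :=
  derivWithin (fun s => Y s z k) I t
    + contractSharp (F.G φ t z) ((1 / 2 : ℝ) • (F.dtG φ t z + F.dtB φ t z)) (Y t z) k

/-- The components in the chart `φ` of the time-dependent vector field `grad_{g_t} u_t`. -/
def grad (F : MetricFormFamily n M I)
    (φ : OpenPartialHomeomorph M (EuclideanSpace ℝ (Fin n))) (u : ℝ → M → ℝ)
    (t : ℝ) : EuclideanSpace ℝ (Fin n) → Fin n → ℝ :=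
  gradVec (F.G φ t) (fun y => u t (φ.symm y))

/-- The time-dependent heat equation `∂_t u = Δ u`, with `Δ = tr_{g_t} ∇∇` at time `t`. -/
def SolvesHeat (F : MetricFormFamily n M I) (u : ℝ → M → ℝ) : Prop :=
  ∀ φ ∈ IsManifold.maximalAtlas (𝓡 n) ∞ M, ∀ t ∈ I, ∀ z ∈ φ.target,
    derivWithin (fun s => u s (φ.symm z)) I t
      = lapFun (F.G φ t) (F.Γ φ t) (fun y => u t (φ.symm y)) z

/-- Generalized Ricci flow: `∂_t g = -2 Rc + ½ H²` and `∂_t b = - d^* H`, where `Rc` is the Ricci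
tensor of the Levi-Civita connection of `g_t` and `H = H₀ + d b_t`. -/
def IsGeneralizedRicciFlow (F : MetricFormFamily n M I) : Prop :=
  ∀ φ ∈ IsManifold.maximalAtlas (𝓡 n) ∞ M, ∀ t ∈ I, ∀ z ∈ φ.target, ∀ i j : Fin n,
    F.dtG φ t z i j
      = -2 * ricci (leviCivita (F.G φ t)) z i j + (1 / 2) * formSq (F.G φ t) (F.H φ t) z i j ∧
    F.dtB φ t z i j = - codiff (F.G φ t) (F.H φ t) z i j

end MetricFormFamily

end GenRicci

end

/-!
The whole statement is local, so it is a computation in a chart. Write `P = g⁻¹` and `α = du`.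

Differentiating `grad u = P α` in time, with `∂_t P = -P (∂_t g) P` and with the commutation of
`∂_t` and `∂_j` (which holds up to the end points of the interval), gives
`∇_t grad u = grad (∂_t u) - ½ ∂_t (g - b) (grad u, ·)^♯` (`MetricFormFamily.nablaT_grad`). By the
heat equation the claim becomes the Bochner formula
`grad (Δ u) = Δ (grad u) - Rc^∇ (grad u, ·)^♯` (`gradVec_lapFun_bismut`) for the Laplacian of the
Bismut connection at a fixed time.

The Bochner formula is reduced to the classical one. Both connections are metric, so indices may be
raised and traces taken under the derivative (`lapVec_raise`, `pd_trace`), and it suffices to compute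
the divergence of `∇α`. For the Levi-Civita connection `D`, the Ricci identity and the skewness of
the curvature give `D^i D_i α_m = D_m (Δ u) + Rc_{ml} α^l` (`divTwo_hess`). Replacing `D` by
`∇ = D + ½ g⁻¹ H` adds `½ (d^* H)_{ml} α^l - ¼ (H²)_{ml} α^l` (`divTwo_hess_bismut`) and leaves `Δ u`
unchanged (`lapFun_bismut`), because all other terms contract a skew pair of indices with a symmetric
one. On the other hand `Rc^∇ = Rc - ½ d^* H - ¼ H²` (`ricci_bismut`). Here `Rc` and `H²` are
symmetric and `d^* H` is skew, so the terms found are exactly `Rc^∇_{lm} α^l`, with the gradient in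
the first slot of `Rc^∇`.

The same formula for `Rc^∇` shows that `½ ∂_t (g - b) = -Rc^∇` along generalized Ricci flow
(`MetricFormFamily.ricciBismut_add_half_dt_eq_zero`), which gives the second claim.

In the computations the coefficients of a connection are matrices `Γ_i` with entries `Γ_{il}^k` in
`(l, k)`. Most of the index calculus is then noncommutative matrix algebra, for instance
`∂_i P = -Γ_iᵀ P - P Γ_i` for a metric connection and
`R_{ij} = ∂_i Γ_j - ∂_j Γ_i + Γ_j Γ_i - Γ_i Γ_j` for the curvature.
-/

noncomputable section

namespace GenRicci

open Matrix

/-! ### Partial derivatives of matrix-valued functions -/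

section Calculus

variable {n : ℕ}

/-- The entrywise partial derivative `∂_i F` of a matrix-valued function. -/
def pdMat (i : Fin n) (F : EuclideanSpace ℝ (Fin n) → Matrix (Fin n) (Fin n) ℝ)
    (z : EuclideanSpace ℝ (Fin n)) : Matrix (Fin n) (Fin n) ℝ :=
  Matrix.of fun a b => pd i (fun y => F y a b) z

/-- The entrywise partial derivative `∂_i V` of a vector-valued function. -/
def pdVec (i : Fin n) (V : EuclideanSpace ℝ (Fin n) → Fin n → ℝ)
    (z : EuclideanSpace ℝ (Fin n)) : Fin n → ℝ :=
  fun a => pd i (fun y => V y a) z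

variable {U : Set (EuclideanSpace ℝ (Fin n))} {z : EuclideanSpace ℝ (Fin n)}

lemma differentiableAt_of_smooth (hU : IsOpen U) {f : EuclideanSpace ℝ (Fin n) → ℝ}
    (hf : ContDiffOn ℝ ∞ f U) (hz : z ∈ U) : DifferentiableAt ℝ f z :=
  (hf.contDiffAt (hU.mem_nhds hz)).differentiableAt (by simp)

lemma contDiffOn_pd (hU : IsOpen U) {f : EuclideanSpace ℝ (Fin n) → ℝ}
    (hf : ContDiffOn ℝ ∞ f U) (i : Fin n) : ContDiffOn ℝ ∞ (fun y => pd i f y) U :=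
  (hf.fderiv_of_isOpen hU (by simp)).clm_apply contDiffOn_const

lemma pd_congr (hU : IsOpen U) {f h : EuclideanSpace ℝ (Fin n) → ℝ} (hfh : EqOn f h U)
    (hz : z ∈ U) (i : Fin n) : pd i f z = pd i h z := by
  unfold pd
  rw [(hfh.eventuallyEq_of_mem (hU.mem_nhds hz)).fderiv_eq]

lemma pd_add {f h : EuclideanSpace ℝ (Fin n) → ℝ} (hf : DifferentiableAt ℝ f z)
    (hh : DifferentiableAt ℝ h z) (i : Fin n) :
    pd i (fun y => f y + h y) z = pd i f z + pd i h z := by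
  simp [pd, fderiv_fun_add hf hh]

lemma pd_sub {f h : EuclideanSpace ℝ (Fin n) → ℝ} (hf : DifferentiableAt ℝ f z)
    (hh : DifferentiableAt ℝ h z) (i : Fin n) :
    pd i (fun y => f y - h y) z = pd i f z - pd i h z := by
  simp [pd, fderiv_fun_sub hf hh]

lemma pd_mul {f h : EuclideanSpace ℝ (Fin n) → ℝ} (hf : DifferentiableAt ℝ f z)
    (hh : DifferentiableAt ℝ h z) (i : Fin n) :
    pd i (fun y => f y * h y) z = pd i f z * h z + f z * pd i h z := by
  simp [pd, fderiv_fun_mul hf hh]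
  ring

lemma pd_const_mul {f : EuclideanSpace ℝ (Fin n) → ℝ} (hf : DifferentiableAt ℝ f z) (c : ℝ)
    (i : Fin n) : pd i (fun y => c * f y) z = c * pd i f z := by
  simp [pd, fderiv_const_mul hf]

lemma pd_sum {ι : Type*} {s : Finset ι} {f : ι → EuclideanSpace ℝ (Fin n) → ℝ}
    (hf : ∀ a ∈ s, DifferentiableAt ℝ (f a) z) (i : Fin n) :
    pd i (fun y => ∑ a ∈ s, f a y) z = ∑ a ∈ s, pd i (f a) z := by
  simp [pd, fderiv_fun_sum hf]

lemma two_le_infty : minSmoothness ℝ 2 ≤ (∞ : ℕ∞ω) := by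
  rw [minSmoothness_of_isRCLikeNormedField]
  exact ENat.LEInfty.out

lemma pd_comm (hU : IsOpen U) {f : EuclideanSpace ℝ (Fin n) → ℝ} (hf : ContDiffOn ℝ ∞ f U)
    (hz : z ∈ U) (i j : Fin n) :
    pd i (fun y => pd j f y) z = pd j (fun y => pd i f y) z := by
  have hfz := hf.contDiffAt (hU.mem_nhds hz)
  have hd : DifferentiableAt ℝ (fderiv ℝ f) z :=
    (hfz.fderiv_right (m := ∞) (by simp)).differentiableAt (by simp)
  have key : ∀ a b : Fin n, pd a (fun y => pd b f y) z
      = fderiv ℝ (fderiv ℝ f) z (basisVec a) (basisVec b) := by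
    intro a b
    simp only [pd]
    rw [fderiv_clm_apply hd (differentiableAt_const _)]
    simp
  rw [key, key]
  exact (hfz.isSymmSndFDerivAt two_le_infty) (basisVec i) (basisVec j)

lemma pdMat_congr (hU : IsOpen U) {F K : EuclideanSpace ℝ (Fin n) → Matrix (Fin n) (Fin n) ℝ}
    (h : EqOn F K U) (hz : z ∈ U) (i : Fin n) : pdMat i F z = pdMat i K z := by
  ext a b
  exact pd_congr hU (fun y hy => by simp only [h hy]) hz i

lemma pdMat_mul {F K : EuclideanSpace ℝ (Fin n) → Matrix (Fin n) (Fin n) ℝ}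
    (hF : ∀ a b, DifferentiableAt ℝ (fun y => F y a b) z)
    (hK : ∀ a b, DifferentiableAt ℝ (fun y => K y a b) z) (i : Fin n) :
    pdMat i (fun y => F y * K y) z = pdMat i F z * K z + F z * pdMat i K z := by
  ext a b
  simp only [pdMat, Matrix.of_apply, Matrix.add_apply, Matrix.mul_apply]
  rw [pd_sum (fun c _ => (hF a c).fun_mul (hK c b)), ← Finset.sum_add_distrib]
  exact Finset.sum_congr rfl fun c _ => pd_mul (hF a c) (hK c b) i

lemma pdMat_add {F K : EuclideanSpace ℝ (Fin n) → Matrix (Fin n) (Fin n) ℝ}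
    (hF : ∀ a b, DifferentiableAt ℝ (fun y => F y a b) z)
    (hK : ∀ a b, DifferentiableAt ℝ (fun y => K y a b) z) (i : Fin n) :
    pdMat i (fun y => F y + K y) z = pdMat i F z + pdMat i K z := by
  ext a b
  exact pd_add (hF a b) (hK a b) i

lemma pdMat_sub {F K : EuclideanSpace ℝ (Fin n) → Matrix (Fin n) (Fin n) ℝ}
    (hF : ∀ a b, DifferentiableAt ℝ (fun y => F y a b) z)
    (hK : ∀ a b, DifferentiableAt ℝ (fun y => K y a b) z) (i : Fin n) :
    pdMat i (fun y => F y - K y) z = pdMat i F z - pdMat i K z := by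
  ext a b
  exact pd_sub (hF a b) (hK a b) i

lemma pdMat_smul {F : EuclideanSpace ℝ (Fin n) → Matrix (Fin n) (Fin n) ℝ}
    (hF : ∀ a b, DifferentiableAt ℝ (fun y => F y a b) z) (c : ℝ) (i : Fin n) :
    pdMat i (fun y => c • F y) z = c • pdMat i F z := by
  ext a b
  exact pd_const_mul (hF a b) c i

lemma pdVec_mulVec {F : EuclideanSpace ℝ (Fin n) → Matrix (Fin n) (Fin n) ℝ}
    {V : EuclideanSpace ℝ (Fin n) → Fin n → ℝ}
    (hF : ∀ a b, DifferentiableAt ℝ (fun y => F y a b) z)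
    (hV : ∀ a, DifferentiableAt ℝ (fun y => V y a) z) (i : Fin n) :
    pdVec i (fun y => F y *ᵥ V y) z = pdMat i F z *ᵥ V z + F z *ᵥ pdVec i V z := by
  ext a
  simp only [pdVec, pdMat, Matrix.mulVec, dotProduct, Pi.add_apply, Matrix.of_apply]
  rw [pd_sum (fun c _ => (hF a c).fun_mul (hV c)), ← Finset.sum_add_distrib]
  exact Finset.sum_congr rfl fun c _ => pd_mul (hF a c) (hV c) i

lemma pdVec_sub {V W : EuclideanSpace ℝ (Fin n) → Fin n → ℝ}
    (hV : ∀ a, DifferentiableAt ℝ (fun y => V y a) z)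
    (hW : ∀ a, DifferentiableAt ℝ (fun y => W y a) z) (i : Fin n) :
    pdVec i (fun y => V y - W y) z = pdVec i V z - pdVec i W z := by
  ext a
  exact pd_sub (hV a) (hW a) i

lemma contDiffOn_inv_entry {X : Type*} [NormedAddCommGroup X] [NormedSpace ℝ X] {s : Set X}
    {F : X → Matrix (Fin n) (Fin n) ℝ} (hF : ∀ a b, ContDiffOn ℝ ∞ (fun x => F x a b) s)
    (hdet : ∀ x ∈ s, IsUnit (F x).det) (a b : Fin n) :
    ContDiffOn ℝ ∞ (fun x => (F x)⁻¹ a b) s := by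
  have det_smooth : ∀ K : X → Matrix (Fin n) (Fin n) ℝ,
      (∀ a b, ContDiffOn ℝ ∞ (fun x => K x a b) s) → ContDiffOn ℝ ∞ (fun x => (K x).det) s := by
    intro K hK
    simp only [Matrix.det_apply, Units.smul_def, zsmul_eq_mul]
    exact ContDiffOn.sum fun σ _ => contDiffOn_const.mul (contDiffOn_prod fun c _ => hK _ _)
  simp only [Matrix.inv_def, Matrix.smul_apply, Ring.inverse_eq_inv', smul_eq_mul,
    Matrix.adjugate_apply]
  refine ((det_smooth F hF).inv fun x hx => (hdet x hx).ne_zero).mul (det_smooth _ fun c d => ?_)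
  by_cases hc : c = b
  · subst hc
    simpa using contDiffOn_const
  · simpa [Matrix.updateRow_ne hc] using hF c d

/-- The differential of the inverse of a matrix, from the Leibniz rule for `A⁻¹ * A = 1`. -/
lemma eq_neg_inv_mul_mul_inv {A A' P' : Matrix (Fin n) (Fin n) ℝ} (hA : IsUnit A.det)
    (h : P' * A + A⁻¹ * A' = 0) : P' = -(A⁻¹ * A' * A⁻¹) := by
  have h1 : P' * A * A⁻¹ = P' := Matrix.mul_nonsing_inv_cancel_right _ _ hA
  rw [← h1, eq_neg_of_add_eq_zero_left h, Matrix.neg_mul]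

end Calculus

/-! ### Metric connections and the raising of indices -/

section MetricConnections

variable {n : ℕ}

/-- The connection coefficients as a matrix for each direction `i`; the entry `(l, k)` is
`Γ_{il}^k`, so that `∇_i V = ∂_i V + Γ_iᵀ V` on vector fields and `∇_i α = ∂_i α - Γ_i α` on
one-forms. -/
def chr (Γ : EuclideanSpace ℝ (Fin n) → Fin n → Fin n → Fin n → ℝ) (i : Fin n)
    (z : EuclideanSpace ℝ (Fin n)) : Matrix (Fin n) (Fin n) ℝ :=
  Matrix.of fun l k => Γ z i l k

/-- The connection `Γ` is compatible with the metric whose inverse matrix is `P`: the covariant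
derivative of `P` vanishes on `U`. -/
def IsMetricConn (U : Set (EuclideanSpace ℝ (Fin n)))
    (P : EuclideanSpace ℝ (Fin n) → Matrix (Fin n) (Fin n) ℝ)
    (Γ : EuclideanSpace ℝ (Fin n) → Fin n → Fin n → Fin n → ℝ) : Prop :=
  ∀ z ∈ U, ∀ i, pdMat i P z = -((chr Γ i z)ᵀ * P z) - P z * chr Γ i z

/-- The covariant derivative `(∇_i A)_{jm}` of a covariant two-tensor, as a matrix in `(j, m)`. -/
def covTwo (Γ : EuclideanSpace ℝ (Fin n) → Fin n → Fin n → Fin n → ℝ)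
    (A : EuclideanSpace ℝ (Fin n) → Matrix (Fin n) (Fin n) ℝ) (i : Fin n)
    (z : EuclideanSpace ℝ (Fin n)) : Matrix (Fin n) (Fin n) ℝ :=
  pdMat i A z - chr Γ i z * A z - A z * (chr Γ i z)ᵀ

/-- The covariant derivative of a one-form, as a matrix-valued function with entries
`(∇_i α)_j`. -/
def hess (Γ : EuclideanSpace ℝ (Fin n) → Fin n → Fin n → Fin n → ℝ)
    (α : EuclideanSpace ℝ (Fin n) → Fin n → ℝ) (y : EuclideanSpace ℝ (Fin n)) :
    Matrix (Fin n) (Fin n) ℝ :=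
  Matrix.of (covOneForm Γ α y)

/-- The divergence `P^{ij} (∇_i A)_{jm}` of a covariant two-tensor. -/
def divTwo (P : EuclideanSpace ℝ (Fin n) → Matrix (Fin n) (Fin n) ℝ)
    (Γ : EuclideanSpace ℝ (Fin n) → Fin n → Fin n → Fin n → ℝ)
    (A : EuclideanSpace ℝ (Fin n) → Matrix (Fin n) (Fin n) ℝ)
    (z : EuclideanSpace ℝ (Fin n)) (m : Fin n) : ℝ :=
  ∑ i, ∑ j, P z i j * covTwo Γ A i z j m

/-- The curvature operator `R(∂_i, ∂_j)` as a matrix; the entry `(k, l)` is `R_{ijk}^l`. -/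
def curvMat (Γ : EuclideanSpace ℝ (Fin n) → Fin n → Fin n → Fin n → ℝ) (i j : Fin n)
    (z : EuclideanSpace ℝ (Fin n)) : Matrix (Fin n) (Fin n) ℝ :=
  Matrix.of fun k l => curvature Γ z i j k l

variable {U : Set (EuclideanSpace ℝ (Fin n))} {z : EuclideanSpace ℝ (Fin n)}
  {P A : EuclideanSpace ℝ (Fin n) → Matrix (Fin n) (Fin n) ℝ}
  {Γ : EuclideanSpace ℝ (Fin n) → Fin n → Fin n → Fin n → ℝ}
  {α : EuclideanSpace ℝ (Fin n) → Fin n → ℝ}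

lemma covOneForm_eq (i : Fin n) :
    covOneForm Γ α z i = pdVec i α z - chr Γ i z *ᵥ α z := rfl

lemma covVec_eq (V : EuclideanSpace ℝ (Fin n) → Fin n → ℝ) (i : Fin n) :
    covVec Γ V z i = pdVec i V z + (chr Γ i z)ᵀ *ᵥ V z := rfl

lemma covEnd_eq (W : EuclideanSpace ℝ (Fin n) → Fin n → Fin n → ℝ) (i j : Fin n) :
    covEnd Γ W z i j = pdVec i (fun y => W y j) z - ∑ l, Γ z i j l • W z l
      + (chr Γ i z)ᵀ *ᵥ W z j := by
  ext k
  simp [covEnd, pdVec, chr, Matrix.mulVec, dotProduct, Finset.sum_apply]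

lemma covTwo_row (i j : Fin n) :
    covTwo Γ A i z j = pdVec i (fun y => A y j) z - ∑ l, Γ z i j l • A z l
      - chr Γ i z *ᵥ A z j := by
  ext m
  simp [covTwo, pdVec, pdMat, chr, Matrix.mulVec, dotProduct, Finset.sum_apply, Matrix.mul_apply,
    mul_comm]

lemma curvMat_eq (i j : Fin n) :
    curvMat Γ i j z = pdMat i (chr Γ j) z - pdMat j (chr Γ i) z
      + chr Γ j z * chr Γ i z - chr Γ i z * chr Γ j z := by
  ext k l
  simp only [curvMat, curvature, pdMat, chr, Matrix.of_apply, Matrix.add_apply, Matrix.sub_apply,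
    Matrix.mul_apply, Finset.sum_sub_distrib, mul_comm]
  ring

lemma sum_mul_eq_trace (B C : Matrix (Fin n) (Fin n) ℝ) :
    ∑ i, ∑ j, B i j * C i j = (B * Cᵀ).trace := by
  simp [Matrix.trace, Matrix.mul_apply]

/-- Metric connections commute with the raising of an index of a one-form. -/
lemma covVec_raise (hP : IsMetricConn U P Γ) (hz : z ∈ U)
    (hPd : ∀ a b, DifferentiableAt ℝ (fun y => P y a b) z)
    (hα : ∀ a, DifferentiableAt ℝ (fun y => α y a) z) (i : Fin n) :
    covVec Γ (fun y => P y *ᵥ α y) z i = P z *ᵥ covOneForm Γ α z i := by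
  rw [covVec_eq, covOneForm_eq, pdVec_mulVec hPd hα, hP z hz]
  simp only [Matrix.sub_mulVec, Matrix.neg_mulVec, Matrix.mulVec_sub, Matrix.mulVec_mulVec]
  abel

/-- Metric connections commute with the raising of an index of a two-tensor. -/
lemma covEnd_raise (hP : IsMetricConn U P Γ) (hz : z ∈ U)
    (hPd : ∀ a b, DifferentiableAt ℝ (fun y => P y a b) z)
    (hA : ∀ a b, DifferentiableAt ℝ (fun y => A y a b) z) (i j : Fin n) :
    covEnd Γ (fun y j => P y *ᵥ A y j) z i j = P z *ᵥ covTwo Γ A i z j := by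
  rw [covEnd_eq, covTwo_row, pdVec_mulVec hPd (hA j), hP z hz]
  simp only [Matrix.sub_mulVec, Matrix.neg_mulVec, Matrix.mulVec_sub, Matrix.mulVec_mulVec,
    Matrix.mulVec_sum, Matrix.mulVec_smul]
  abel

lemma covEnd_congr (hU : IsOpen U) (hz : z ∈ U)
    {W W' : EuclideanSpace ℝ (Fin n) → Fin n → Fin n → ℝ} (h : EqOn W W' U) (i j : Fin n) :
    covEnd Γ W z i j = covEnd Γ W' z i j := by
  have h1 : pdVec i (fun y => W y j) z = pdVec i (fun y => W' y j) z := by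
    ext k
    exact pd_congr hU (fun y hy => by simp only [h hy]) hz i
  rw [covEnd_eq, covEnd_eq, h1, h hz]

lemma contDiffOn_hess (hU : IsOpen U)
    (hΓ : ∀ i j k, ContDiffOn ℝ ∞ (fun y => Γ y i j k) U)
    (hα : ∀ a, ContDiffOn ℝ ∞ (fun y => α y a) U) (a b : Fin n) :
    ContDiffOn ℝ ∞ (fun y => hess Γ α y a b) U :=
  (contDiffOn_pd hU (hα b) a).sub (ContDiffOn.sum fun l _ => (hΓ a b l).mul (hα l))

/-- The Laplacian of the vector field dual to a one-form `α` is dual to the divergence of `∇α`. -/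
lemma lapVec_raise {G : EuclideanSpace ℝ (Fin n) → Matrix (Fin n) (Fin n) ℝ} (hU : IsOpen U)
    (hP : IsMetricConn U (fun y => (G y)⁻¹) Γ)
    (hPs : ∀ a b, ContDiffOn ℝ ∞ (fun y => (G y)⁻¹ a b) U)
    (hΓ : ∀ i j k, ContDiffOn ℝ ∞ (fun y => Γ y i j k) U)
    (hα : ∀ a, ContDiffOn ℝ ∞ (fun y => α y a) U) (hz : z ∈ U) :
    lapVec G Γ (fun y => (G y)⁻¹ *ᵥ α y) z
      = (G z)⁻¹ *ᵥ divTwo (fun y => (G y)⁻¹) Γ (hess Γ α) z := by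
  have h1 : EqOn (covVec Γ (fun y => (G y)⁻¹ *ᵥ α y))
      (fun y j => (G y)⁻¹ *ᵥ hess Γ α y j) U := fun y hy => by
    ext1 i
    exact covVec_raise hP hy (fun a b => differentiableAt_of_smooth hU (hPs a b) hy)
      (fun a => differentiableAt_of_smooth hU (hα a) hy) i
  have h2 : ∀ i j, covEnd Γ (covVec Γ (fun y => (G y)⁻¹ *ᵥ α y)) z i j
      = (G z)⁻¹ *ᵥ covTwo Γ (hess Γ α) i z j := fun i j => by
    rw [covEnd_congr hU hz h1]
    exact covEnd_raise hP hz (fun a b => differentiableAt_of_smooth hU (hPs a b) hz)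
      (fun a b => differentiableAt_of_smooth hU (contDiffOn_hess hU hΓ hα a b) hz) i j
  have h3 : divTwo (fun y => (G y)⁻¹) Γ (hess Γ α) z
      = ∑ i, ∑ j, (G z)⁻¹ i j • covTwo Γ (hess Γ α) i z j := by
    ext m
    simp [divTwo, Finset.sum_apply]
  ext k
  simp only [lapVec, h2, h3, Matrix.mulVec_sum, Matrix.mulVec_smul, Finset.sum_apply,
    Pi.smul_apply, smul_eq_mul]

/-- Metric connections commute with the trace of a two-tensor. -/
lemma pd_trace (hP : IsMetricConn U P Γ) (hz : z ∈ U)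
    (hPd : ∀ a b, DifferentiableAt ℝ (fun y => P y a b) z)
    (hA : ∀ a b, DifferentiableAt ℝ (fun y => A y a b) z) (m : Fin n) :
    pd m (fun y => ∑ i, ∑ j, P y i j * A y i j) z
      = ∑ i, ∑ j, P z i j * covTwo Γ A m z i j := by
  have h1 : pd m (fun y => ∑ i, ∑ j, P y i j * A y i j) z
      = (∑ i, ∑ j, pdMat m P z i j * A z i j) + ∑ i, ∑ j, P z i j * pdMat m A z i j := by
    rw [pd_sum fun i _ => DifferentiableAt.fun_sum fun j _ => (hPd i j).fun_mul (hA i j),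
      ← Finset.sum_add_distrib]
    refine Finset.sum_congr rfl fun i _ => ?_
    rw [pd_sum fun j _ => (hPd i j).fun_mul (hA i j), ← Finset.sum_add_distrib]
    exact Finset.sum_congr rfl fun j _ => pd_mul (hPd i j) (hA i j) m
  rw [h1, sum_mul_eq_trace, sum_mul_eq_trace, sum_mul_eq_trace, hP z hz, covTwo]
  simp only [Matrix.transpose_sub, Matrix.transpose_mul, Matrix.transpose_transpose,
    Matrix.mul_sub, Matrix.sub_mul, Matrix.neg_mul, Matrix.trace_sub, Matrix.trace_neg,
    Matrix.mul_assoc]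
  rw [Matrix.trace_mul_comm (chr Γ m z)ᵀ]
  simp only [Matrix.mul_assoc]
  ring

lemma differentiableAt_chr (hU : IsOpen U)
    (hΓ : ∀ i j k, ContDiffOn ℝ ∞ (fun y => Γ y i j k) U) (hz : z ∈ U) (i a b : Fin n) :
    DifferentiableAt ℝ (fun y => chr Γ i y a b) z :=
  differentiableAt_of_smooth hU (hΓ i a b) hz

/-- The curvature of a metric connection is skew: the second derivatives of `P` commute. -/
lemma curvMat_skew (hU : IsOpen U) (hP : IsMetricConn U P Γ)
    (hPs : ∀ a b, ContDiffOn ℝ ∞ (fun y => P y a b) U)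
    (hΓ : ∀ i j k, ContDiffOn ℝ ∞ (fun y => Γ y i j k) U) (hz : z ∈ U) (i j : Fin n) :
    (curvMat Γ i j z)ᵀ * P z + P z * curvMat Γ i j z = 0 := by
  have hPd : ∀ a b, DifferentiableAt ℝ (fun y => P y a b) z :=
    fun a b => differentiableAt_of_smooth hU (hPs a b) hz
  have second : ∀ a b : Fin n, pdMat a (fun y => pdMat b P y) z
      = -((pdMat a (chr Γ b) z)ᵀ * P z + (chr Γ b z)ᵀ * pdMat a P z)
        - (pdMat a P z * chr Γ b z + P z * pdMat a (chr Γ b) z) := by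
    intro a b
    have hΓb := differentiableAt_chr hU hΓ hz b
    have hΓbT : ∀ c d, DifferentiableAt ℝ (fun y => (chr Γ b y)ᵀ c d) z := fun c d => hΓb d c
    have hmul : ∀ {F K : EuclideanSpace ℝ (Fin n) → Matrix (Fin n) (Fin n) ℝ},
        (∀ c d, DifferentiableAt ℝ (fun y => F y c d) z) →
        (∀ c d, DifferentiableAt ℝ (fun y => K y c d) z) →
        ∀ c d, DifferentiableAt ℝ (fun y => (F y * K y) c d) z := by
      intro F K hF hK c d
      simp only [Matrix.mul_apply]
      exact DifferentiableAt.fun_sum fun e _ => (hF c e).fun_mul (hK e d)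
    have e1 : pdMat a (fun y => pdMat b P y) z
        = pdMat a (fun y => (-1 : ℝ) • ((chr Γ b y)ᵀ * P y) - P y * chr Γ b y) z :=
      pdMat_congr hU (fun y hy => by simp only [hP y hy b, neg_smul, one_smul]) hz a
    have hneg : ∀ c d, DifferentiableAt ℝ (fun y => ((-1 : ℝ) • ((chr Γ b y)ᵀ * P y)) c d) z :=
      fun c d => (hmul hΓbT hPd c d).const_mul (-1)
    rw [e1, pdMat_sub hneg (hmul hPd hΓb),
      pdMat_smul (hmul hΓbT hPd), pdMat_mul hΓbT hPd, pdMat_mul hPd hΓb, neg_smul, one_smul]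
    rfl
  have hcomm : pdMat i (fun y => pdMat j P y) z = pdMat j (fun y => pdMat i P y) z := by
    ext a b
    exact pd_comm hU (hPs a b) hz i j
  rw [second, second, hP z hz, hP z hz] at hcomm
  rw [curvMat_eq]
  simp only [Matrix.transpose_sub, Matrix.transpose_add, Matrix.transpose_mul]
  rw [← sub_eq_zero] at hcomm
  rw [← neg_eq_zero, ← hcomm]
  noncomm_ring

/-- The Ricci identity for the differential of a function and a torsion-free connection. -/
lemma covTwo_hess_comm {f : EuclideanSpace ℝ (Fin n) → ℝ} (hU : IsOpen U)
    (hsymm : ∀ y ∈ U, ∀ i j k, Γ y i j k = Γ y j i k)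
    (hΓ : ∀ i j k, ContDiffOn ℝ ∞ (fun y => Γ y i j k) U)
    (hf : ContDiffOn ℝ ∞ f U) (hz : z ∈ U) (i m : Fin n) :
    covTwo Γ (hess Γ fun y l => pd l f y) i z m - covTwo Γ (hess Γ fun y l => pd l f y) m z i
      = -(curvMat Γ i m z *ᵥ fun l => pd l f z) := by
  set α : EuclideanSpace ℝ (Fin n) → Fin n → ℝ := fun y l => pd l f y
  have hαs : ∀ a, ContDiffOn ℝ ∞ (fun y => α y a) U := fun a => contDiffOn_pd hU hf a
  have hα : ∀ a, DifferentiableAt ℝ (fun y => α y a) z :=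
    fun a => differentiableAt_of_smooth hU (hαs a) hz
  have row : ∀ a b : Fin n, covTwo Γ (hess Γ α) a z b
      = pdVec a (pdVec b α) z - (pdMat a (chr Γ b) z *ᵥ α z + chr Γ b z *ᵥ pdVec a α z)
        - ∑ l, Γ z a b l • hess Γ α z l - chr Γ a z *ᵥ (pdVec b α z - chr Γ b z *ᵥ α z) := by
    intro a b
    have hmv : ∀ c, DifferentiableAt ℝ (fun y => (chr Γ b y *ᵥ α y) c) z := fun c => by
      simp only [Matrix.mulVec, dotProduct]
      exact DifferentiableAt.fun_sum fun e _ => (differentiableAt_chr hU hΓ hz b c e).fun_mul (hα e)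
    have e : pdVec a (fun y => hess Γ α y b) z
        = pdVec a (pdVec b α) z
          - (pdMat a (chr Γ b) z *ᵥ α z + chr Γ b z *ᵥ pdVec a α z) := by
      rw [← pdVec_mulVec (differentiableAt_chr hU hΓ hz b) hα]
      exact pdVec_sub (V := pdVec b α)
        (fun c => differentiableAt_of_smooth hU (contDiffOn_pd hU (hαs c) b) hz) hmv a
    rw [covTwo_row, e]
    rfl
  have hcomm : pdVec i (pdVec m α) z = pdVec m (pdVec i α) z := by
    ext c
    exact pd_comm hU (hαs c) hz i m
  have hs : ∑ l, Γ z i m l • hess Γ α z l = ∑ l, Γ z m i l • hess Γ α z l :=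
    Finset.sum_congr rfl fun l _ => by rw [hsymm z hz]
  change _ = -(curvMat Γ i m z *ᵥ α z)
  rw [row, row, hcomm, hs, curvMat_eq]
  simp only [Matrix.add_mulVec, Matrix.sub_mulVec, Matrix.mulVec_sub, Matrix.mulVec_mulVec]
  abel

lemma hess_symm {f : EuclideanSpace ℝ (Fin n) → ℝ} (hU : IsOpen U)
    (hsymm : ∀ y ∈ U, ∀ i j k, Γ y i j k = Γ y j i k) (hf : ContDiffOn ℝ ∞ f U) (hz : z ∈ U)
    (i j : Fin n) :
    hess Γ (fun y l => pd l f y) z i j = hess Γ (fun y l => pd l f y) z j i := by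
  simp only [hess, covOneForm, Matrix.of_apply, hsymm z hz i j]
  rw [pd_comm hU hf hz i j]

lemma covTwo_symm (hU : IsOpen U) (hA : ∀ y ∈ U, (A y)ᵀ = A y) (hz : z ∈ U) (i : Fin n) :
    (covTwo Γ A i z)ᵀ = covTwo Γ A i z := by
  have h : (pdMat i A z)ᵀ = pdMat i A z :=
    pdMat_congr (F := fun y => (A y)ᵀ) hU (fun y hy => hA y hy) hz i
  simp only [covTwo, Matrix.transpose_sub, Matrix.transpose_mul, Matrix.transpose_transpose, h,
    hA z hz]
  abel

lemma trace_curvMat {G : EuclideanSpace ℝ (Fin n) → Matrix (Fin n) (Fin n) ℝ}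
    (hdet : IsUnit (G z).det) {i j : Fin n}
    (h : (curvMat Γ i j z)ᵀ * (G z)⁻¹ + (G z)⁻¹ * curvMat Γ i j z = 0) :
    (curvMat Γ i j z).trace = 0 := by
  have h1 : curvMat Γ i j z = -(G z * ((curvMat Γ i j z)ᵀ * (G z)⁻¹)) := by
    rw [eq_neg_of_add_eq_zero_left h, Matrix.mul_neg, neg_neg,
      Matrix.mul_nonsing_inv_cancel_left _ _ hdet]
  have h2 : (curvMat Γ i j z).trace = -(curvMat Γ i j z).trace := by
    conv_lhs => rw [h1, Matrix.trace_neg, Matrix.trace_mul_comm, Matrix.mul_assoc,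
      Matrix.nonsing_inv_mul _ hdet, Matrix.mul_one, Matrix.trace_transpose]
  linarith

/-- The first Bianchi identity of a torsion-free connection. -/
lemma curvature_bianchi (hU : IsOpen U)
    (hsymm : ∀ y ∈ U, ∀ i j k, Γ y i j k = Γ y j i k) (hz : z ∈ U) (i j k l : Fin n) :
    curvature Γ z i j k l + curvature Γ z j k i l + curvature Γ z k i j l = 0 := by
  have hpd : ∀ a b c, pd a (fun y => Γ y b c l) z = pd a (fun y => Γ y c b l) z :=
    fun a b c => pd_congr hU (fun y hy => hsymm y hy b c l) hz a
  simp only [curvature, Finset.sum_sub_distrib]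
  rw [hpd j i k, hpd k j i, hpd i k j]
  simp only [hsymm z hz i k, hsymm z hz j i, hsymm z hz k j]
  ring

/-- The Ricci tensor of a torsion-free metric connection is symmetric. -/
lemma ricci_symm {G : EuclideanSpace ℝ (Fin n) → Matrix (Fin n) (Fin n) ℝ} (hU : IsOpen U)
    (hsymm : ∀ y ∈ U, ∀ i j k, Γ y i j k = Γ y j i k)
    (hP : IsMetricConn U (fun y => (G y)⁻¹) Γ)
    (hPs : ∀ a b, ContDiffOn ℝ ∞ (fun y => (G y)⁻¹ a b) U)
    (hΓ : ∀ i j k, ContDiffOn ℝ ∞ (fun y => Γ y i j k) U) (hz : z ∈ U)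
    (hdet : IsUnit (G z).det) (j k : Fin n) : ricci Γ z j k = ricci Γ z k j := by
  have htr := trace_curvMat hdet (curvMat_skew hU hP hPs hΓ hz j k)
  simp only [Matrix.trace, Matrix.diag, curvMat, Matrix.of_apply] at htr
  have h : ∑ i, (curvature Γ z i j k i + curvature Γ z j k i i + curvature Γ z k i j i) = 0 :=
    Finset.sum_eq_zero fun i _ => curvature_bianchi hU hsymm hz i j k i
  have hanti : ∀ i, curvature Γ z k i j i = -curvature Γ z i k j i := fun i => by
    simp only [curvature, Finset.sum_sub_distrib]
    ring
  simp only [Finset.sum_add_distrib, htr, hanti, Finset.sum_neg_distrib] at h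
  simp only [ricci]
  linarith

/-- The classical Bochner formula `D^i D_i α_m = D_m (Δ f) + Rc_{ml} α^l` for `α = df`. -/
lemma divTwo_hess {G : EuclideanSpace ℝ (Fin n) → Matrix (Fin n) (Fin n) ℝ}
    {f : EuclideanSpace ℝ (Fin n) → ℝ} (hU : IsOpen U)
    (hsymm : ∀ y ∈ U, ∀ i j k, Γ y i j k = Γ y j i k)
    (hP : IsMetricConn U (fun y => (G y)⁻¹) Γ)
    (hPs : ∀ a b, ContDiffOn ℝ ∞ (fun y => (G y)⁻¹ a b) U)
    (hΓ : ∀ i j k, ContDiffOn ℝ ∞ (fun y => Γ y i j k) U)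
    (hf : ContDiffOn ℝ ∞ f U) (hz : z ∈ U) (m : Fin n) :
    divTwo (fun y => (G y)⁻¹) Γ (hess Γ fun y l => pd l f y) z m
      = pd m (lapFun G Γ f) z + ∑ l, ricci Γ z m l * gradVec G f z l := by
  set A := hess Γ fun y l => pd l f y
  have hPd := fun a b => differentiableAt_of_smooth hU (hPs a b) hz
  have hAs := contDiffOn_hess hU hΓ fun a => contDiffOn_pd hU hf a
  have hcov : ∀ i j, covTwo Γ A i z j m
      = covTwo Γ A m z i j - (curvMat Γ i m z *ᵥ fun l => pd l f z) j := by
    intro i j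
    have h1 : covTwo Γ A i z j m = covTwo Γ A i z m j :=
      congrFun (congrFun (covTwo_symm hU (fun y hy => by
        ext a b; exact hess_symm hU hsymm hf hy b a) hz i) m) j
    have h2 := congrFun (covTwo_hess_comm hU hsymm hΓ hf hz i m) j
    simp only [Pi.sub_apply, Pi.neg_apply] at h2
    rw [h1]
    linarith
  have hlap : pd m (lapFun G Γ f) z = ∑ i, ∑ j, (G z)⁻¹ i j * covTwo Γ A m z i j :=
    pd_trace hP hz hPd (fun a b => differentiableAt_of_smooth hU (hAs a b) hz) m
  have hcurv : ∑ i, ∑ j, (G z)⁻¹ i j * (curvMat Γ i m z *ᵥ fun l => pd l f z) j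
      = -∑ l, ricci Γ z m l * gradVec G f z l := by
    have e1 : ∀ i, ∑ j, (G z)⁻¹ i j * (curvMat Γ i m z *ᵥ fun l => pd l f z) j
        = -∑ p, curvature Γ z i m p i * gradVec G f z p := by
      intro i
      have : ((G z)⁻¹ * curvMat Γ i m z) *ᵥ (fun l => pd l f z)
          = -((curvMat Γ i m z)ᵀ *ᵥ gradVec G f z) := by
        rw [eq_neg_of_add_eq_zero_right (curvMat_skew hU hP hPs hΓ hz i m), Matrix.neg_mulVec,
          ← Matrix.mulVec_mulVec]
        rfl
      rw [← Matrix.mulVec_mulVec] at this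
      exact congrFun this i
    simp only [e1, Finset.sum_neg_distrib]
    rw [Finset.sum_comm]
    simp only [ricci, Finset.sum_mul]
  rw [hlap]
  simp only [divTwo, hcov, mul_sub, Finset.sum_sub_distrib, hcurv]
  ring

end MetricConnections

/-! ### The Levi-Civita connection -/

section LeviCivita

variable {n : ℕ}

/-- `G` is the matrix of a smooth nondegenerate symmetric bilinear form on the open set `U`.
Definiteness plays no role in the tensor calculus. -/
structure IsMetricOn (U : Set (EuclideanSpace ℝ (Fin n)))
    (G : EuclideanSpace ℝ (Fin n) → Matrix (Fin n) (Fin n) ℝ) : Prop where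
  isOpen : IsOpen U
  smooth : ∀ i j, ContDiffOn ℝ ∞ (fun y => G y i j) U
  symm : ∀ z ∈ U, (G z)ᵀ = G z
  isUnit_det : ∀ z ∈ U, IsUnit (G z).det

/-- The lowered Christoffel symbols `½ (∂_i g_{jl} + ∂_j g_{il} - ∂_l g_{ij})`, as a matrix
in `(j, l)`. -/
def loweredChr (G : EuclideanSpace ℝ (Fin n) → Matrix (Fin n) (Fin n) ℝ) (i : Fin n)
    (z : EuclideanSpace ℝ (Fin n)) : Matrix (Fin n) (Fin n) ℝ :=
  Matrix.of fun j l => (1 / 2) * (pd i (fun y => G y j l) z + pd j (fun y => G y i l) z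
    - pd l (fun y => G y i j) z)

variable {U : Set (EuclideanSpace ℝ (Fin n))} {z : EuclideanSpace ℝ (Fin n)}
  {G : EuclideanSpace ℝ (Fin n) → Matrix (Fin n) (Fin n) ℝ}

lemma chr_leviCivita (i : Fin n) :
    chr (leviCivita G) i z = loweredChr G i z * (G z)⁻¹ := by
  ext j k
  simp only [chr, leviCivita, loweredChr, Matrix.of_apply, Matrix.mul_apply, Finset.mul_sum,
    mul_assoc]

namespace IsMetricOn

variable (hG : IsMetricOn U G)

include hG

lemma inv_symm (hz : z ∈ U) : ((G z)⁻¹)ᵀ = (G z)⁻¹ := by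
  rw [Matrix.transpose_nonsing_inv, hG.symm z hz]

lemma inv_symm_apply (hz : z ∈ U) (i j : Fin n) : (G z)⁻¹ i j = (G z)⁻¹ j i :=
  congrFun (congrFun (hG.inv_symm hz) j) i

lemma contDiffOn_inv (i j : Fin n) : ContDiffOn ℝ ∞ (fun y => (G y)⁻¹ i j) U :=
  contDiffOn_inv_entry hG.smooth hG.isUnit_det i j

lemma pd_symm (hz : z ∈ U) (i j l : Fin n) :
    pd l (fun y => G y i j) z = pd l (fun y => G y j i) z :=
  pd_congr hG.isOpen (fun y hy => congrFun (congrFun (hG.symm y hy) j) i) hz l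

lemma pdMat_inv (hz : z ∈ U) (i : Fin n) :
    pdMat i (fun y => (G y)⁻¹) z = -((G z)⁻¹ * pdMat i G z * (G z)⁻¹) := by
  refine eq_neg_inv_mul_mul_inv (hG.isUnit_det z hz) ?_
  rw [← pdMat_mul (fun a b => differentiableAt_of_smooth hG.isOpen (hG.contDiffOn_inv a b) hz)
    (fun a b => differentiableAt_of_smooth hG.isOpen (hG.smooth a b) hz),
    pdMat_congr (K := fun _ => 1) hG.isOpen
      (fun y hy => Matrix.nonsing_inv_mul _ (hG.isUnit_det y hy)) hz]
  ext a b
  simp [pdMat, pd]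

lemma loweredChr_add_transpose (hz : z ∈ U) (i : Fin n) :
    loweredChr G i z + (loweredChr G i z)ᵀ = pdMat i G z := by
  ext j l
  simp only [loweredChr, pdMat, Matrix.add_apply, Matrix.transpose_apply, Matrix.of_apply]
  rw [hG.pd_symm hz l j i]
  ring

lemma isMetricConn_leviCivita : IsMetricConn U (fun y => (G y)⁻¹) (leviCivita G) := by
  intro z hz i
  rw [hG.pdMat_inv hz, ← hG.loweredChr_add_transpose hz, chr_leviCivita, Matrix.transpose_mul,
    hG.inv_symm hz]
  noncomm_ring

lemma leviCivita_symm (hz : z ∈ U) (i j k : Fin n) :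
    leviCivita G z i j k = leviCivita G z j i k := by
  simp only [leviCivita]
  congr 1
  refine Finset.sum_congr rfl fun l _ => ?_
  rw [hG.pd_symm hz i j l]
  ring

lemma contDiffOn_leviCivita (i j k : Fin n) :
    ContDiffOn ℝ ∞ (fun y => leviCivita G y i j k) U :=
  contDiffOn_const.mul <| ContDiffOn.sum fun l _ =>
    (((contDiffOn_pd hG.isOpen (hG.smooth j l) i).add
      (contDiffOn_pd hG.isOpen (hG.smooth i l) j)).sub
      (contDiffOn_pd hG.isOpen (hG.smooth i j) l)).mul (hG.contDiffOn_inv l k)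

end IsMetricOn

end LeviCivita

/-! ### The Bismut connection -/

section Bismut

variable {n : ℕ}

/-- `H` is a smooth totally skew tensor on `U`. -/
structure IsThreeFormOn (U : Set (EuclideanSpace ℝ (Fin n)))
    (H : EuclideanSpace ℝ (Fin n) → Fin n → Fin n → Fin n → ℝ) : Prop where
  smooth : ∀ i j k, ContDiffOn ℝ ∞ (fun y => H y i j k) U
  swap_left : ∀ y i j k, H y i j k = -H y j i k
  swap_right : ∀ y i j k, H y i j k = -H y i k j

/-- The contraction `∂_i ⌟ H` as a matrix, with entries `H_{ijl}` in `(j, l)`. -/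
def formMat (H : EuclideanSpace ℝ (Fin n) → Fin n → Fin n → Fin n → ℝ) (i : Fin n)
    (z : EuclideanSpace ℝ (Fin n)) : Matrix (Fin n) (Fin n) ℝ :=
  Matrix.of fun j l => H z i j l

/-- The difference of the Bismut and the Levi-Civita connection in the direction `i`, with entries
`½ H_{ijl} g^{lk}` in `(j, k)`. -/
def torsionMat (G : EuclideanSpace ℝ (Fin n) → Matrix (Fin n) (Fin n) ℝ)
    (H : EuclideanSpace ℝ (Fin n) → Fin n → Fin n → Fin n → ℝ) (i : Fin n)
    (z : EuclideanSpace ℝ (Fin n)) : Matrix (Fin n) (Fin n) ℝ :=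
  (1 / 2 : ℝ) • (formMat H i z * (G z)⁻¹)

/-- The Levi-Civita derivative `(D_i H)_{jkl}`, as a matrix in `(k, l)`. -/
def covFormMat (G : EuclideanSpace ℝ (Fin n) → Matrix (Fin n) (Fin n) ℝ)
    (H : EuclideanSpace ℝ (Fin n) → Fin n → Fin n → Fin n → ℝ) (i j : Fin n)
    (z : EuclideanSpace ℝ (Fin n)) : Matrix (Fin n) (Fin n) ℝ :=
  Matrix.of fun k l => covThree (leviCivita G) H z i j k l

variable {U : Set (EuclideanSpace ℝ (Fin n))} {z : EuclideanSpace ℝ (Fin n)}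
  {G : EuclideanSpace ℝ (Fin n) → Matrix (Fin n) (Fin n) ℝ}
  {H : EuclideanSpace ℝ (Fin n) → Fin n → Fin n → Fin n → ℝ}

lemma sum_symm_mul_skew {S : Matrix (Fin n) (Fin n) ℝ} {A : Fin n → Fin n → ℝ}
    (hS : ∀ i j, S i j = S j i) (hA : ∀ i j, A i j = -A j i) : ∑ i, ∑ j, S i j * A i j = 0 := by
  have h : ∑ i, ∑ j, S i j * A i j = -∑ i, ∑ j, S i j * A i j := by
    conv_lhs => rw [Finset.sum_comm]
    simp only [← Finset.sum_neg_distrib]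
    refine Finset.sum_congr rfl fun i _ => Finset.sum_congr rfl fun j _ => ?_
    rw [hS j i, hA j i]
    ring
  linarith

lemma chr_bismut (i : Fin n) :
    chr (bismut G H) i z = chr (leviCivita G) i z + torsionMat G H i z := by
  ext j k
  simp [chr, bismut, torsionMat, formMat, Matrix.mul_apply]

lemma covFormMat_eq (i j : Fin n) :
    covFormMat G H i j z = pdMat i (formMat H j) z - ∑ m, leviCivita G z i j m • formMat H m z
      - chr (leviCivita G) i z * formMat H j z - formMat H j z * (chr (leviCivita G) i z)ᵀ := by
  ext k l
  simp [covFormMat, covThree, pdMat, formMat, chr, Matrix.mul_apply, Matrix.sum_apply, mul_comm]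

lemma formSq_eq_trace (i j : Fin n) :
    formSq G H z i j
      = ((formMat H i z)ᵀ * ((G z)⁻¹ * (formMat H j z * ((G z)⁻¹)ᵀ))).trace := by
  simp only [formSq, Matrix.trace, Matrix.diag, Matrix.mul_apply, Matrix.transpose_apply, formMat,
    Matrix.of_apply, Finset.mul_sum]
  rw [Finset.sum_comm]
  refine Finset.sum_congr rfl fun l _ => Finset.sum_congr rfl fun k _ =>
    Finset.sum_congr rfl fun p _ => Finset.sum_congr rfl fun q _ => ?_
  ring

namespace IsThreeFormOn

variable (hH : IsThreeFormOn U H)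

include hH

lemma cycle (y : EuclideanSpace ℝ (Fin n)) (i j k : Fin n) : H y i j k = H y k i j := by
  rw [hH.swap_right, hH.swap_left, neg_neg]

lemma swap_outer (y : EuclideanSpace ℝ (Fin n)) (i j k : Fin n) : H y i j k = -H y k j i := by
  rw [hH.cycle, hH.swap_right]

lemma formMat_transpose (i : Fin n) : (formMat H i z)ᵀ = -formMat H i z := by
  ext a b
  exact hH.swap_right z i b a

lemma covThree_swap_left {Γ : EuclideanSpace ℝ (Fin n) → Fin n → Fin n → Fin n → ℝ}
    (i j k l : Fin n) : covThree Γ H z i j k l = -covThree Γ H z i k j l := by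
  have h1 : pd i (fun y => H y j k l) z = -pd i (fun y => H y k j l) z := by
    simp only [fun y => hH.swap_left y j k l]
    simp [pd]
  simp only [covThree, h1, fun m => hH.swap_left z m k l, fun m => hH.swap_left z j m l,
    fun m => hH.swap_left z j k m, mul_neg, Finset.sum_neg_distrib]
  ring

lemma covThree_swap_right {Γ : EuclideanSpace ℝ (Fin n) → Fin n → Fin n → Fin n → ℝ}
    (i j k l : Fin n) : covThree Γ H z i j k l = -covThree Γ H z i j l k := by
  have h1 : pd i (fun y => H y j k l) z = -pd i (fun y => H y j l k) z := by
    simp only [fun y => hH.swap_right y j k l]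
    simp [pd]
  simp only [covThree, h1, fun m => hH.swap_right z m k l, fun m => hH.swap_right z j m l,
    fun m => hH.swap_right z j k m, mul_neg, Finset.sum_neg_distrib]
  ring

lemma covThree_cycle {Γ : EuclideanSpace ℝ (Fin n) → Fin n → Fin n → Fin n → ℝ}
    (i j k l : Fin n) : covThree Γ H z i j k l = covThree Γ H z i l j k := by
  rw [hH.covThree_swap_right, hH.covThree_swap_left, neg_neg]

lemma covThree_swap_outer {Γ : EuclideanSpace ℝ (Fin n) → Fin n → Fin n → Fin n → ℝ}
    (i j k l : Fin n) : covThree Γ H z i j k l = -covThree Γ H z i l k j := by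
  rw [hH.covThree_cycle, hH.covThree_swap_right]

lemma codiff_skew (i j : Fin n) : codiff G H z i j = -codiff G H z j i := by
  simp only [codiff, fun k l => hH.covThree_swap_right k l i j (z := z) (Γ := leviCivita G),
    mul_neg, Finset.sum_neg_distrib]

lemma differentiableAt_formMat (hU : IsOpen U) (hz : z ∈ U) (i a b : Fin n) :
    DifferentiableAt ℝ (fun y => formMat H i y a b) z :=
  differentiableAt_of_smooth hU (hH.smooth i a b) hz

end IsThreeFormOn

lemma formSq_symm (hG : IsMetricOn U G) (hz : z ∈ U) (i j : Fin n) :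
    formSq G H z i j = formSq G H z j i := by
  rw [formSq_eq_trace, formSq_eq_trace, ← Matrix.trace_transpose]
  simp only [Matrix.transpose_mul, Matrix.transpose_transpose, Matrix.mul_assoc, hG.inv_symm hz]
  rw [Matrix.trace_mul_comm]
  simp only [Matrix.mul_assoc]

lemma torsionMat_mulVec (i j : Fin n) (v : Fin n → ℝ) :
    (torsionMat G H i z *ᵥ v) j = (1 / 2) * ∑ l, H z i j l * ((G z)⁻¹ *ᵥ v) l := by
  rw [torsionMat, Matrix.smul_mulVec, ← Matrix.mulVec_mulVec]
  rfl

variable (hG : IsMetricOn U G) (hH : IsThreeFormOn U H)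

include hG hH

lemma isMetricConn_bismut : IsMetricConn U (fun y => (G y)⁻¹) (bismut G H) := by
  intro z hz i
  rw [hG.isMetricConn_leviCivita z hz, chr_bismut, torsionMat]
  simp only [Matrix.transpose_add, Matrix.transpose_smul, Matrix.transpose_mul,
    hH.formMat_transpose, hG.inv_symm hz, Matrix.add_mul, Matrix.mul_add, Matrix.mul_neg,
    Matrix.neg_mul, Matrix.smul_mul, Matrix.mul_smul, Matrix.mul_assoc]
  module

lemma contDiffOn_bismut (i j k : Fin n) : ContDiffOn ℝ ∞ (fun y => bismut G H y i j k) U :=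
  (hG.contDiffOn_leviCivita i j k).add <| contDiffOn_const.mul <| ContDiffOn.sum fun l _ =>
    (hH.smooth i j l).mul (hG.contDiffOn_inv l k)

/-- The Bismut curvature in terms of the Levi-Civita curvature: changing a connection by a tensor `C`
adds the skew-symmetrized derivative of `C` and the commutator `[C_j, C_i]`. -/
lemma curvMat_bismut (hz : z ∈ U) (i j : Fin n) :
    curvMat (bismut G H) i j z = curvMat (leviCivita G) i j z
      + (1 / 2 : ℝ) • ((covFormMat G H i j z - covFormMat G H j i z) * (G z)⁻¹)
      + torsionMat G H j z * torsionMat G H i z - torsionMat G H i z * torsionMat G H j z := by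
  have hPd : ∀ a b, DifferentiableAt ℝ (fun y => (G y)⁻¹ a b) z :=
    fun a b => differentiableAt_of_smooth hG.isOpen (hG.contDiffOn_inv a b) hz
  have hd : ∀ a b : Fin n, pdMat a (chr (bismut G H) b) z = pdMat a (chr (leviCivita G) b) z
      + (1 / 2 : ℝ) • (pdMat a (formMat H b) z * (G z)⁻¹
        + formMat H b z * (-((chr (leviCivita G) a z)ᵀ * (G z)⁻¹)
          - (G z)⁻¹ * chr (leviCivita G) a z)) := by
    intro a b
    have hHd := hH.differentiableAt_formMat hG.isOpen hz b
    have hm : ∀ c d, DifferentiableAt ℝ (fun y => (formMat H b y * (G y)⁻¹) c d) z := by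
      intro c d
      simp only [Matrix.mul_apply]
      exact DifferentiableAt.fun_sum fun e _ => (hHd c e).fun_mul (hPd e d)
    have hs : ∀ c d, DifferentiableAt ℝ
        (fun y => ((1 / 2 : ℝ) • (formMat H b y * (G y)⁻¹)) c d) z :=
      fun c d => (hm c d).const_mul (1 / 2)
    have e1 : pdMat a (chr (bismut G H) b) z = pdMat a (fun y => chr (leviCivita G) b y
        + (1 / 2 : ℝ) • (formMat H b y * (G y)⁻¹)) z :=
      pdMat_congr hG.isOpen (fun y _ => chr_bismut b) hz a
    rw [e1, pdMat_add (differentiableAt_chr hG.isOpen hG.contDiffOn_leviCivita hz b) hs,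
      pdMat_smul hm, pdMat_mul hHd hPd, hG.isMetricConn_leviCivita z hz]
  have hs : ∑ m, leviCivita G z i j m • formMat H m z
      = ∑ m, leviCivita G z j i m • formMat H m z :=
    Finset.sum_congr rfl fun m _ => by rw [hG.leviCivita_symm hz]
  rw [curvMat_eq, curvMat_eq, hd, hd, chr_bismut, chr_bismut, covFormMat_eq, covFormMat_eq, hs,
    torsionMat, torsionMat]
  simp only [Matrix.add_mul, Matrix.mul_add, Matrix.mul_neg, Matrix.smul_mul, Matrix.mul_smul,
    Matrix.sub_mul, Matrix.mul_sub, Matrix.mul_assoc]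
  module

/-- The Ricci tensor of the Bismut connection: `Rc^∇ = Rc - ½ d^* H - ¼ H²`. -/
theorem ricci_bismut (hz : z ∈ U) (j k : Fin n) :
    ricci (bismut G H) z j k = ricci (leviCivita G) z j k - (1 / 2) * codiff G H z j k
      - (1 / 4) * formSq G H z j k := by
  have hcurv : ∀ i, curvature (bismut G H) z i j k i = curvature (leviCivita G) z i j k i
      + (1 / 2) * ((covFormMat G H i j z * (G z)⁻¹) k i
        - (covFormMat G H j i z * (G z)⁻¹) k i)
      + (torsionMat G H j z * torsionMat G H i z) k i
      - (torsionMat G H i z * torsionMat G H j z) k i := by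
    intro i
    have h := congrFun (congrFun (curvMat_bismut hG hH hz i j) k) i
    rw [Matrix.sub_mul] at h
    exact h
  have t1 : ∑ i, (covFormMat G H i j z * (G z)⁻¹) k i = -codiff G H z j k := by
    simp only [codiff, neg_neg, Matrix.mul_apply, covFormMat, Matrix.of_apply]
    refine Finset.sum_congr rfl fun i _ => Finset.sum_congr rfl fun l _ => ?_
    rw [hH.covThree_cycle i j k l, hG.inv_symm_apply hz l i, mul_comm]
  have t2 : ∑ i, (covFormMat G H j i z * (G z)⁻¹) k i = 0 := by
    simp only [Matrix.mul_apply, covFormMat, Matrix.of_apply]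
    rw [← sum_symm_mul_skew (S := (G z)⁻¹) (A := fun i l => covThree (leviCivita G) H z j i k l)
      (hG.inv_symm_apply hz) (fun i l => hH.covThree_swap_outer j i k l)]
    refine Finset.sum_congr rfl fun i _ => Finset.sum_congr rfl fun l _ => ?_
    rw [hG.inv_symm_apply hz l i]
    exact mul_comm _ _
  have t3 : ∑ i, (torsionMat G H j z * torsionMat G H i z) k i = 0 := by
    have h : ∀ a, ∑ i, torsionMat G H i z a i = 0 := by
      intro a
      have h0 := sum_symm_mul_skew (S := (G z)⁻¹) (A := fun i l => H z i a l)
        (hG.inv_symm_apply hz) (fun i l => hH.swap_outer z i a l)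
      simp only [torsionMat, Matrix.smul_apply, Matrix.mul_apply, formMat, Matrix.of_apply,
        ← Finset.smul_sum]
      rw [smul_eq_zero]
      right
      rw [← h0]
      refine Finset.sum_congr rfl fun i _ => Finset.sum_congr rfl fun l _ => ?_
      rw [hG.inv_symm_apply hz l i]
      exact mul_comm _ _
    simp only [Matrix.mul_apply]
    rw [Finset.sum_comm]
    simp only [← Finset.mul_sum, h, mul_zero, Finset.sum_const_zero]
  have t4 : ∑ i, (torsionMat G H i z * torsionMat G H j z) k i
      = (1 / 4) * formSq G H z j k := by
    have e1 : ∀ i, (torsionMat G H i z * torsionMat G H j z) k i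
        = (1 / 4) * -(formMat H k z * ((G z)⁻¹ * (formMat H j z * (G z)⁻¹))) i i := by
      intro i
      have e2 : torsionMat G H i z * torsionMat G H j z
          = (1 / 4 : ℝ) • (formMat H i z * ((G z)⁻¹ * (formMat H j z * (G z)⁻¹))) := by
        simp only [torsionMat, Matrix.smul_mul, Matrix.mul_smul, Matrix.mul_assoc, smul_smul]
        norm_num
      rw [e2, Matrix.smul_apply, smul_eq_mul, Matrix.mul_apply, Matrix.mul_apply,
        ← Finset.sum_neg_distrib]
      congr 1
      refine Finset.sum_congr rfl fun a _ => ?_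
      simp only [formMat, Matrix.of_apply]
      rw [hH.swap_left z i k a, neg_mul]
    simp only [e1, ← Finset.mul_sum, Finset.sum_neg_distrib]
    rw [formSq_symm hG hz, formSq_eq_trace, hH.formMat_transpose, hG.inv_symm hz, Matrix.neg_mul,
      Matrix.trace_neg]
    rfl
  simp only [ricci, hcurv, Finset.sum_add_distrib, Finset.sum_sub_distrib, ← Finset.mul_sum, t1,
    t2, t3, t4]
  ring

/-- The Bismut and the Levi-Civita connection have the same Laplacian on functions. -/
lemma lapFun_bismut (f : EuclideanSpace ℝ (Fin n) → ℝ) (hz : z ∈ U) :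
    lapFun G (bismut G H) f z = lapFun G (leviCivita G) f z := by
  have h : ∀ i j, covOneForm (bismut G H) (fun y l => pd l f y) z i j
      = covOneForm (leviCivita G) (fun y l => pd l f y) z i j
        - (torsionMat G H i z *ᵥ fun l => pd l f z) j := by
    intro i j
    rw [covOneForm_eq, covOneForm_eq, chr_bismut, Matrix.add_mulVec]
    simp only [Pi.sub_apply, Pi.add_apply]
    ring
  have h0 := sum_symm_mul_skew (S := (G z)⁻¹)
    (A := fun i j => (torsionMat G H i z *ᵥ fun l => pd l f z) j) (hG.inv_symm_apply hz)
    (fun i j => by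
      simp only [torsionMat_mulVec, hH.swap_left z i j, neg_mul, Finset.sum_neg_distrib, mul_neg])
  simp only [lapFun, h, mul_sub, Finset.sum_sub_distrib]
  exact sub_eq_self.2 h0

/-- The divergence of the Bismut Hessian of a function:
`∇^i ∇_i α_m = D^i D_i α_m + ½ (d^* H)_{ml} α^l - ¼ (H²)_{ml} α^l` for `α = df`. All other terms
contract a symmetric with a skew pair of indices. -/
lemma divTwo_hess_bismut {f : EuclideanSpace ℝ (Fin n) → ℝ} (hf : ContDiffOn ℝ ∞ f U)
    (hz : z ∈ U) (m : Fin n) :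
    divTwo (fun y => (G y)⁻¹) (bismut G H) (hess (bismut G H) fun y l => pd l f y) z m
      = divTwo (fun y => (G y)⁻¹) (leviCivita G) (hess (leviCivita G) fun y l => pd l f y) z m
        + ∑ l, ((1 / 2) * codiff G H z m l - (1 / 4) * formSq G H z m l) * gradVec G f z l := by
  set α : EuclideanSpace ℝ (Fin n) → Fin n → ℝ := fun y l => pd l f y
  set A := hess (leviCivita G) α
  set P : Matrix (Fin n) (Fin n) ℝ := (G z)⁻¹ with hPdef
  have hPs : ∀ i j, P i j = P j i := hG.inv_symm_apply hz
  set V : EuclideanSpace ℝ (Fin n) → Fin n → ℝ := fun y => (G y)⁻¹ *ᵥ α y with hV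
  -- `K` is half the contraction of `H` with the gradient, so that the Bismut Hessian is `A - K`.
  set K : EuclideanSpace ℝ (Fin n) → Matrix (Fin n) (Fin n) ℝ :=
    fun y => Matrix.of fun j => (1 / 2 : ℝ) • (formMat H j y *ᵥ V y) with hK
  have hαs : ∀ a, ContDiffOn ℝ ∞ (fun y => α y a) U := fun a => contDiffOn_pd hG.isOpen hf a
  have hVs : ∀ a, ContDiffOn ℝ ∞ (fun y => V y a) U := fun a => by
    simp only [hV, Matrix.mulVec, dotProduct]
    exact ContDiffOn.sum fun l _ => (hG.contDiffOn_inv a l).mul (hαs l)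
  have hKs : ∀ a b, ContDiffOn ℝ ∞ (fun y => K y a b) U := fun a b => by
    simp only [hK, Matrix.of_apply, Pi.smul_apply, smul_eq_mul, Matrix.mulVec, dotProduct]
    exact contDiffOn_const.mul (ContDiffOn.sum fun l _ => (hH.smooth a b l).mul (hVs l))
  have hAs := contDiffOn_hess hG.isOpen hG.contDiffOn_leviCivita hαs
  have dAt : ∀ {h : EuclideanSpace ℝ (Fin n) → ℝ}, ContDiffOn ℝ ∞ h U → DifferentiableAt ℝ h z :=
    fun hh => differentiableAt_of_smooth hG.isOpen hh hz
  have hB : ∀ y, hess (bismut G H) α y = A y - K y := by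
    intro y
    ext j b
    have h : covOneForm (bismut G H) α y j
        = covOneForm (leviCivita G) α y j - torsionMat G H j y *ᵥ α y := by
      rw [covOneForm_eq, covOneForm_eq, chr_bismut, Matrix.add_mulVec]
      abel
    have h' : torsionMat G H j y *ᵥ α y = (1 / 2 : ℝ) • (formMat H j y *ᵥ V y) := by
      rw [torsionMat, Matrix.smul_mulVec, ← Matrix.mulVec_mulVec]
    rw [h'] at h
    exact congrFun h b
  have hcovK : ∀ i j, covTwo (leviCivita G) K i z j
      = (1 / 2 : ℝ) • (covFormMat G H i j z *ᵥ V z + formMat H j z *ᵥ (P *ᵥ A z i)) := by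
    intro i j
    have hHd := hH.differentiableAt_formMat hG.isOpen hz j
    have e1 : pdVec i (fun y => K y j) z = (1 / 2 : ℝ) • (pdMat i (formMat H j) z *ᵥ V z
        + formMat H j z *ᵥ pdVec i V z) := by
      rw [← pdVec_mulVec hHd (fun a => dAt (hVs a))]
      have hd : ∀ b, DifferentiableAt ℝ (fun y => (formMat H j y *ᵥ V y) b) z := fun b => by
        simp only [Matrix.mulVec, dotProduct]
        exact DifferentiableAt.fun_sum fun l _ => (hHd b l).fun_mul (dAt (hVs l))
      ext b
      exact pd_const_mul (hd b) _ _
    have e2 : P *ᵥ A z i = pdVec i V z + (chr (leviCivita G) i z)ᵀ *ᵥ V z := by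
      rw [← covVec_eq]
      exact (covVec_raise hG.isMetricConn_leviCivita hz (fun a b => dAt (hG.contDiffOn_inv a b))
        (fun a => dAt (hαs a)) i).symm
    have e3 : ∀ l, K z l = (1 / 2 : ℝ) • (formMat H l z *ᵥ V z) := fun l => rfl
    rw [covTwo_row, e1, e2, covFormMat_eq]
    simp only [e3, Matrix.sub_mulVec, Matrix.sum_mulVec, Matrix.smul_mulVec, Matrix.mulVec_add,
      Matrix.mulVec_mulVec, Matrix.mulVec_smul, smul_comm _ (1 / 2 : ℝ), ← Finset.smul_sum]
    module
  have hrow : ∀ i j, covTwo (bismut G H) (hess (bismut G H) α) i z j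
      = covTwo (leviCivita G) A i z j - covTwo (leviCivita G) K i z j
        - ∑ l, torsionMat G H i z j l • (A z l - K z l)
        - torsionMat G H i z *ᵥ (A z j - K z j) := by
    intro i j
    have e1 : covTwo (bismut G H) (hess (bismut G H) α) i z
        = covTwo (leviCivita G) A i z - covTwo (leviCivita G) K i z
          - torsionMat G H i z * (A z - K z) - (A z - K z) * (torsionMat G H i z)ᵀ := by
      have e2 : pdMat i (hess (bismut G H) α) z = pdMat i A z - pdMat i K z := by
        rw [← pdMat_sub (fun a b => dAt (hAs a b)) (fun a b => dAt (hKs a b))]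
        exact pdMat_congr hG.isOpen (fun y _ => hB y) hz i
      simp only [covTwo, e2, hB, chr_bismut, Matrix.transpose_add]
      noncomm_ring
    rw [e1]
    ext b
    simp [Matrix.mul_apply, Matrix.mulVec, dotProduct, Finset.sum_apply, mul_comm]
  -- The contraction of `H` with a symmetrized two-tensor in its first and third slot.
  have hcontr : ∀ W : Matrix (Fin n) (Fin n) ℝ,
      ∑ i, ∑ j, P i j * (formMat H j z *ᵥ (P *ᵥ W i)) m
        = ∑ j, ∑ q, (P * W * P) j q * H z j m q := by
    intro W
    have e1 : ∀ i, P *ᵥ W i = fun q => (W * P) i q := by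
      intro i
      ext q
      simp only [Matrix.mulVec, dotProduct, Matrix.mul_apply]
      exact Finset.sum_congr rfl fun l _ => by rw [hPs q l]; exact mul_comm _ _
    simp only [e1]
    rw [Finset.sum_comm]
    refine Finset.sum_congr rfl fun j _ => ?_
    simp only [Matrix.mulVec, dotProduct, Finset.mul_sum]
    rw [Finset.sum_comm]
    refine Finset.sum_congr rfl fun q _ => ?_
    rw [Matrix.mul_assoc, Matrix.mul_apply, Finset.sum_mul]
    refine Finset.sum_congr rfl fun i _ => ?_
    rw [hPs j i]
    simp only [formMat, Matrix.of_apply]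
    ring
  have hPT : Pᵀ = P := hG.inv_symm hz
  have hAT : (A z)ᵀ = A z := by
    ext a b
    exact hess_symm hG.isOpen (fun y hy => hG.leviCivita_symm hy) hf hz b a
  have hcontrA : ∑ j, ∑ q, (P * A z * P) j q * H z j m q = 0 := by
    refine sum_symm_mul_skew (fun i j => ?_) (fun i j => hH.swap_outer z i m j)
    have : (P * A z * P)ᵀ = P * A z * P := by
      simp only [Matrix.transpose_mul, hPT, hAT, Matrix.mul_assoc]
    exact congrFun (congrFun this j) i
  have hcontrK : ∑ j, ∑ q, (P * K z * P) j q * H z j m q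
      = -((1 / 2) * ∑ r, formSq G H z m r * V z r) := by
    have e1 : K z = (1 / 2 : ℝ) • ∑ r, V z r • formMat H r z := by
      ext j p
      simp only [hK, Matrix.of_apply, Pi.smul_apply, Matrix.mulVec, dotProduct, Matrix.smul_apply,
        Matrix.sum_apply, formMat, smul_eq_mul]
      congr 1
      exact Finset.sum_congr rfl fun r _ => by rw [hH.cycle z j p r, mul_comm]
    have e2 : ∑ j, ∑ q, (P * K z * P) j q * H z j m q
        = -(P * K z * P * (formMat H m z)ᵀ).trace := by
      rw [← sum_mul_eq_trace, ← Finset.sum_neg_distrib]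
      refine Finset.sum_congr rfl fun j _ => ?_
      rw [← Finset.sum_neg_distrib]
      refine Finset.sum_congr rfl fun q _ => ?_
      rw [hH.swap_left z j m q, mul_neg]
      rfl
    have e3 : ∀ r, formSq G H z m r = (P * formMat H r z * P * (formMat H m z)ᵀ).trace := by
      intro r
      rw [formSq_eq_trace, Matrix.trace_mul_comm, hG.inv_symm hz]
      simp only [Matrix.mul_assoc, hPdef]
    rw [e2, e1]
    simp only [e3, Matrix.mul_smul, Matrix.smul_mul, Matrix.mul_sum, Matrix.sum_mul,
      Matrix.trace_smul, Matrix.trace_sum, smul_eq_mul, mul_comm (V z _)]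
  have s1 : ∑ i, ∑ j, P i j * covTwo (leviCivita G) K i z j m
      = -((1 / 2) * ∑ l, codiff G H z m l * V z l) := by
    have e1 : ∑ i, ∑ j, P i j * (covFormMat G H i j z *ᵥ V z) m
        = -∑ l, codiff G H z m l * V z l := by
      simp only [codiff, neg_mul, Finset.sum_neg_distrib, neg_neg, Matrix.mulVec, dotProduct,
        covFormMat, Matrix.of_apply, Finset.mul_sum, Finset.sum_mul]
      symm
      rw [Finset.sum_comm]
      refine Finset.sum_congr rfl fun i _ => ?_
      rw [Finset.sum_comm]
      exact Finset.sum_congr rfl fun j _ => Finset.sum_congr rfl fun q _ => mul_assoc _ _ _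
    have e2 := hcontr (A z)
    rw [hcontrA] at e2
    have e3 : ∀ i j, P i j * covTwo (leviCivita G) K i z j m
        = (1 / 2) * (P i j * (covFormMat G H i j z *ᵥ V z) m)
          + (1 / 2) * (P i j * (formMat H j z *ᵥ (P *ᵥ A z i)) m) := by
      intro i j
      rw [hcovK]
      simp only [Pi.smul_apply, Pi.add_apply, smul_eq_mul]
      ring
    simp only [e3, Finset.sum_add_distrib, ← Finset.mul_sum]
    rw [e1, e2]
    ring
  have s2 : ∑ i, ∑ j, P i j * (∑ l, torsionMat G H i z j l • (A z l - K z l)) m = 0 := by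
    refine sum_symm_mul_skew (hG.inv_symm_apply hz) fun i j => ?_
    have : ∀ l, torsionMat G H i z j l = -torsionMat G H j z i l := fun l => by
      simp only [torsionMat, formMat, Matrix.smul_apply, Matrix.mul_apply, Matrix.of_apply,
        hH.swap_left z i j, neg_mul, Finset.sum_neg_distrib, smul_neg]
    simp only [this, neg_smul, Finset.sum_neg_distrib, Pi.neg_apply]
  have s3 : ∑ i, ∑ j, P i j * (torsionMat G H i z *ᵥ (A z j - K z j)) m
      = (1 / 4) * ∑ r, formSq G H z m r * V z r := by
    have e1 := hcontr (A z - K z)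
    have e2 : ∑ i, ∑ j, P i j * (torsionMat G H i z *ᵥ (A z j - K z j)) m
        = (1 / 2) * ∑ i, ∑ j, P i j * (formMat H j z *ᵥ (P *ᵥ (A z - K z) i)) m := by
      rw [Finset.sum_comm]
      simp only [Finset.mul_sum]
      refine Finset.sum_congr rfl fun i _ => Finset.sum_congr rfl fun j _ => ?_
      rw [torsionMat, Matrix.smul_mulVec, ← Matrix.mulVec_mulVec, hPs j i, Pi.smul_apply,
        smul_eq_mul, mul_left_comm]
      rfl
    rw [e2, e1]
    simp only [Matrix.mul_sub, Matrix.sub_apply, sub_mul, Finset.sum_sub_distrib]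
    rw [hcontrA, hcontrK]
    ring
  have hsum : divTwo (fun y => (G y)⁻¹) (bismut G H) (hess (bismut G H) α) z m
      = ∑ i, ∑ j, P i j * covTwo (leviCivita G) A i z j m
        - ∑ i, ∑ j, P i j * covTwo (leviCivita G) K i z j m
        - ∑ i, ∑ j, P i j * (∑ l, torsionMat G H i z j l • (A z l - K z l)) m
        - ∑ i, ∑ j, P i j * (torsionMat G H i z *ᵥ (A z j - K z j)) m := by
    simp only [divTwo, hrow, Pi.sub_apply, mul_sub, Finset.sum_sub_distrib, hPdef]
  have hgrad : ∀ l, gradVec G f z l = V z l := fun l => rfl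
  rw [hsum, s1, s2, s3]
  simp only [hgrad, sub_mul, Finset.sum_sub_distrib, mul_assoc, ← Finset.mul_sum, divTwo, hPdef]
  ring

/-- The Bochner formula of the Bismut connection:
`grad (Δ f) = Δ (grad f) - Rc^∇ (grad f, ·)^♯`. -/
theorem gradVec_lapFun_bismut {f : EuclideanSpace ℝ (Fin n) → ℝ} (hf : ContDiffOn ℝ ∞ f U)
    (hz : z ∈ U) (k : Fin n) :
    gradVec G (lapFun G (bismut G H) f) z k
      = lapVec G (bismut G H) (gradVec G f) z k
        - contractSharp (G z) (Matrix.of (ricci (bismut G H) z)) (gradVec G f z) k := by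
  have hlap : lapVec G (bismut G H) (gradVec G f) z = (G z)⁻¹ *ᵥ
      divTwo (fun y => (G y)⁻¹) (bismut G H) (hess (bismut G H) fun y l => pd l f y) z :=
    lapVec_raise hG.isOpen (isMetricConn_bismut hG hH) hG.contDiffOn_inv
      (contDiffOn_bismut hG hH) (fun a => contDiffOn_pd hG.isOpen hf a) hz
  have hdiv : ∀ m,
      divTwo (fun y => (G y)⁻¹) (bismut G H) (hess (bismut G H) fun y l => pd l f y) z m
        = pd m (lapFun G (bismut G H) f) z
          + ∑ l, ricci (bismut G H) z l m * gradVec G f z l := by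
    intro m
    rw [divTwo_hess_bismut hG hH hf hz, divTwo_hess hG.isOpen (fun y hy => hG.leviCivita_symm hy)
      hG.isMetricConn_leviCivita hG.contDiffOn_inv hG.contDiffOn_leviCivita hf hz,
      pd_congr hG.isOpen (fun y hy => lapFun_bismut hG hH f hy) hz, add_assoc,
      ← Finset.sum_add_distrib]
    congr 1
    refine Finset.sum_congr rfl fun l _ => ?_
    rw [ricci_bismut hG hH hz, ricci_symm hG.isOpen (fun y hy => hG.leviCivita_symm hy)
      hG.isMetricConn_leviCivita hG.contDiffOn_inv hG.contDiffOn_leviCivita hz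
      (hG.isUnit_det z hz) l m, hH.codiff_skew l m, formSq_symm hG hz l m]
    ring
  have hsharp : contractSharp (G z) (Matrix.of (ricci (bismut G H) z)) (gradVec G f z) k
      = ∑ m, (G z)⁻¹ k m * ∑ l, ricci (bismut G H) z l m * gradVec G f z l := by
    simp only [contractSharp, Matrix.of_apply, Finset.mul_sum]
    rw [Finset.sum_comm]
    refine Finset.sum_congr rfl fun m _ => Finset.sum_congr rfl fun l _ => ?_
    rw [hG.inv_symm_apply hz m k]
    exact mul_comm _ _
  rw [hlap, hsharp]
  simp only [gradVec, Matrix.mulVec, dotProduct, hdiv, mul_add, Finset.sum_add_distrib]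
  ring

end Bismut

/-! ### Time derivatives -/

section Time

variable {n : ℕ}

lemma slice_derivs {F : Type*} [NormedAddCommGroup F] [NormedSpace ℝ F]
    {I : Set ℝ} {U : Set (EuclideanSpace ℝ (Fin n))} (hU : IsOpen U)
    {f : ℝ × EuclideanSpace ℝ (Fin n) → F}
    {f' : ℝ × EuclideanSpace ℝ (Fin n) →L[ℝ] F} {t : ℝ} {z : EuclideanSpace ℝ (Fin n)}
    (ht : t ∈ I) (hz : z ∈ U) (hf : HasFDerivWithinAt f f' (I ×ˢ U) (t, z)) :
    HasDerivWithinAt (fun s => f (s, z)) (f' (1, 0)) I t ∧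
      HasFDerivAt (fun y => f (t, y)) (f'.comp (ContinuousLinearMap.inr ℝ ℝ _)) z := by
  constructor
  · have h1 : HasDerivWithinAt (fun s : ℝ => (s, z)) ((1 : ℝ), (0 : EuclideanSpace ℝ (Fin n)))
        I t := (hasDerivWithinAt_id t I).prodMk (hasDerivWithinAt_const t I z)
    exact hf.comp_hasDerivWithinAt (t := I ×ˢ U) t h1 fun s hs => Set.mk_mem_prod hs hz
  · have h1 : HasFDerivWithinAt (fun y : EuclideanSpace ℝ (Fin n) => (t, y))
        (ContinuousLinearMap.inr ℝ ℝ _) U z := (hasFDerivAt_prodMk_right t z).hasFDerivWithinAt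
    exact (hf.comp z h1 fun y hy => Set.mk_mem_prod ht hy).hasFDerivAt (hU.mem_nhds hz)

/-- The time derivative, one-sided at the end points of the interval, commutes with the partial
derivatives in space. -/
lemma hasDerivWithinAt_pd {I : Set ℝ} (hI : I.OrdConnected) (hI' : I.Nontrivial)
    {U : Set (EuclideanSpace ℝ (Fin n))} (hU : IsOpen U)
    {w : ℝ → EuclideanSpace ℝ (Fin n) → ℝ}
    (hw : ContDiffOn ℝ ∞ (fun p : ℝ × EuclideanSpace ℝ (Fin n) => w p.1 p.2) (I ×ˢ U))
    {t : ℝ} (ht : t ∈ I) {z : EuclideanSpace ℝ (Fin n)} (hz : z ∈ U) (j : Fin n) :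
    HasDerivWithinAt (fun s => pd j (w s) z) (pd j (fun y => derivWithin (fun s => w s y) I t) z)
      I t := by
  have hint : (interior I).Nonempty := hI.convex.nontrivial_iff_nonempty_interior.1 hI'
  have hIu : UniqueDiffOn ℝ I := uniqueDiffOn_convex hI.convex hint
  have hS : UniqueDiffOn ℝ (I ×ˢ U) := hIu.prod hU.uniqueDiffOn
  set f : ℝ × EuclideanSpace ℝ (Fin n) → ℝ := fun p => w p.1 p.2
  set D := fderivWithin ℝ f (I ×ˢ U) with hD
  have hDs : ContDiffOn ℝ ∞ D (I ×ˢ U) := hw.fderivWithin hS (by simp)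
  have first : ∀ s ∈ I, ∀ y ∈ U, HasFDerivWithinAt f (D (s, y)) (I ×ˢ U) (s, y) :=
    fun s hs y hy => (hw.differentiableOn (by simp) (s, y) ⟨hs, hy⟩).hasFDerivWithinAt
  have second : HasFDerivWithinAt D (fderivWithin ℝ D (I ×ˢ U) (t, z)) (I ×ˢ U) (t, z) :=
    (hDs.differentiableOn (by simp) (t, z) ⟨ht, hz⟩).hasFDerivWithinAt
  have hspace : ∀ s ∈ I, pd j (w s) z = D (s, z) (0, basisVec j) := by
    intro s hs
    exact congrArg (fun L : EuclideanSpace ℝ (Fin n) →L[ℝ] ℝ => L (basisVec j))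
      (slice_derivs hU hs hz (first s hs z hz)).2.fderiv
  have htime : ∀ y ∈ U, derivWithin (fun s => w s y) I t = D (t, y) (1, 0) := fun y hy =>
    (slice_derivs hU ht hy (first t ht y hy)).1.derivWithin (hIu t ht)
  have hcl : (t, z) ∈ closure (interior (I ×ˢ U)) := by
    rw [interior_prod_eq, closure_prod_eq, hU.interior_eq,
      Convex.closure_interior_eq_closure_of_nonempty_interior (𝕜 := ℝ) hI.convex hint]
    exact ⟨subset_closure ht, subset_closure hz⟩
  have hsymm := (hw (t, z) ⟨ht, hz⟩).isSymmSndFDerivWithinAt two_le_infty hS hcl ⟨ht, hz⟩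
  have h1 := (slice_derivs hU ht hz second).1
  have h2 := (slice_derivs hU ht hz second).2
  have e : pd j (fun y => derivWithin (fun s => w s y) I t) z
      = fderivWithin ℝ D (I ×ˢ U) (t, z) (1, 0) (0, basisVec j) := by
    rw [pd_congr hU htime hz, hsymm (1, 0) (0, basisVec j)]
    have h3 := h2.clm_apply (hasFDerivAt_const ((1 : ℝ), (0 : EuclideanSpace ℝ (Fin n))) z)
    rw [show pd j (fun y => D (t, y) (1, 0)) z = _ from congrArg (· (basisVec j)) h3.fderiv]
    simp [hD]
  have h4 := h1.clm_apply (hasDerivWithinAt_const t I ((0 : ℝ), basisVec j))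
  rw [e]
  refine (h4.congr hspace (hspace t ht)).congr_deriv ?_
  simp

lemma hasDerivWithinAt_inv {I : Set ℝ} (hI : UniqueDiffOn ℝ I) {A : ℝ → Matrix (Fin n) (Fin n) ℝ}
    (hA : ∀ a b, ContDiffOn ℝ ∞ (fun s => A s a b) I) (hdet : ∀ s ∈ I, IsUnit (A s).det)
    {t : ℝ} (ht : t ∈ I) (a b : Fin n) :
    HasDerivWithinAt (fun s => (A s)⁻¹ a b)
      ((-((A t)⁻¹ * Matrix.of (fun c d => derivWithin (fun s => A s c d) I t) * (A t)⁻¹)) a b)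
      I t := by
  set A' : Matrix (Fin n) (Fin n) ℝ :=
    Matrix.of (fun c d => derivWithin (fun s => A s c d) I t)
  set P' : Matrix (Fin n) (Fin n) ℝ :=
    Matrix.of (fun c d => derivWithin (fun s => (A s)⁻¹ c d) I t)
  have dA : ∀ c d, HasDerivWithinAt (fun s => A s c d) (A' c d) I t := fun c d =>
    ((hA c d).differentiableOn (by simp) t ht).hasDerivWithinAt
  have dP : ∀ c d, HasDerivWithinAt (fun s => (A s)⁻¹ c d) (P' c d) I t := fun c d =>
    ((contDiffOn_inv_entry hA hdet c d).differentiableOn (by simp) t ht).hasDerivWithinAt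
  have h : P' * A t + (A t)⁻¹ * A' = 0 := by
    ext c d
    have h1 : HasDerivWithinAt (fun s => ((A s)⁻¹ * A s) c d)
        ((P' * A t + (A t)⁻¹ * A') c d) I t := by
      simp only [Matrix.mul_apply, Matrix.add_apply, ← Finset.sum_add_distrib]
      exact HasDerivWithinAt.fun_sum fun e _ => (dP c e).fun_mul (dA e d)
    have h2 : HasDerivWithinAt (fun s => ((A s)⁻¹ * A s) c d) 0 I t :=
      (hasDerivWithinAt_const t I ((1 : Matrix (Fin n) (Fin n) ℝ) c d)).congr
        (fun s hs => by rw [Matrix.nonsing_inv_mul _ (hdet s hs)])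
        (by rw [Matrix.nonsing_inv_mul _ (hdet t ht)])
    exact (hI t ht).eq_deriv _ h1 h2
  rw [← eq_neg_inv_mul_mul_inv (hdet t ht) h]
  exact dP a b

end Time

/-! ### Tensors in a chart -/

section InChart

variable {n : ℕ} {M : Type*} [TopologicalSpace M] [ChartedSpace (EuclideanSpace ℝ (Fin n)) M]
  {φ : OpenPartialHomeomorph M (EuclideanSpace ℝ (Fin n))}

lemma chartFrame_injective [IsManifold (𝓡 n) ∞ M] (hφ : φ ∈ IsManifold.maximalAtlas (𝓡 n) ∞ M)
    {z : EuclideanSpace ℝ (Fin n)} (hz : z ∈ φ.target) :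
    Function.Injective (chartFrame φ z) := by
  have hd : φ.MDifferentiable (𝓡 n) (𝓡 n) :=
    ⟨(contMDiffOn_of_mem_maximalAtlas hφ).mdifferentiableOn (by simp),
      (contMDiffOn_symm_of_mem_maximalAtlas hφ).mdifferentiableOn (by simp)⟩
  exact hd.symm.mfderiv_injective (x := z) hz

lemma contDiffOn_inChart (hφ : φ ∈ IsManifold.maximalAtlas (𝓡 n) ∞ M) {I : Set ℝ}
    {u : ℝ → M → ℝ}
    (hu : ContMDiffOn (𝓘(ℝ, ℝ).prod (𝓡 n)) 𝓘(ℝ, ℝ) ∞ (fun p : ℝ × M => u p.1 p.2)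
      (I ×ˢ (Set.univ : Set M))) :
    ContDiffOn ℝ ∞ (fun p : ℝ × EuclideanSpace ℝ (Fin n) => u p.1 (φ.symm p.2))
      (I ×ˢ φ.target) := by
  rw [← contMDiffOn_iff_contDiffOn, modelWithCornersSelf_prod, ← chartedSpaceSelf_prod]
  have h : ContMDiffOn (𝓘(ℝ, ℝ).prod (𝓡 n)) (𝓘(ℝ, ℝ).prod (𝓡 n)) ∞
      (fun p : ℝ × EuclideanSpace ℝ (Fin n) => (p.1, φ.symm p.2)) (I ×ˢ φ.target) :=
    contMDiffOn_fst.prodMk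
      ((contMDiffOn_symm_of_mem_maximalAtlas hφ).comp contMDiffOn_snd fun p hp => hp.2)
  exact hu.comp h fun p hp => ⟨hp.1, mem_univ _⟩

namespace MetricFormFamily

variable {I : Set ℝ} (F : MetricFormFamily n M I)

/-- The matrix of the metric in a chart is nondegenerate: a null vector `v` would give a nonzero
tangent vector `v^i ∂_i` of length zero. -/
lemma isMetricOn_G [IsManifold (𝓡 n) ∞ M] (hφ : φ ∈ IsManifold.maximalAtlas (𝓡 n) ∞ M) {t : ℝ}
    (ht : t ∈ I) : IsMetricOn φ.target (F.G φ t) where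
  isOpen := φ.open_target
  smooth i j := (F.g_smooth φ hφ i j).comp (f := fun y => (t, y))
    (contDiff_prodMk_right t).contDiffOn fun y hy => ⟨ht, hy⟩
  symm z _ := by
    ext i j
    exact F.g_symm t ht _ _ _
  isUnit_det z hz := by
    rw [isUnit_iff_ne_zero]
    intro h0
    obtain ⟨v, hv, hGv⟩ := Matrix.exists_mulVec_eq_zero_iff.2 h0
    set e : EuclideanSpace ℝ (Fin n) := ∑ i, v i • basisVec i with he
    have hei : ∀ i, e i = v i := by
      intro i
      simp [he, basisVec, Pi.single_apply]
    have he0 : chartFrame φ z e ≠ 0 := by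
      rw [Ne, ← map_zero (chartFrame φ z), (chartFrame_injective hφ hz).eq_iff]
      intro h
      exact hv (funext fun i => by rw [← hei i, h]; rfl)
    have hpos := F.g_pos t ht (φ.symm z) _ he0
    have hexp : F.g t (φ.symm z) (chartFrame φ z e) (chartFrame φ z e)
        = ∑ i, v i * (F.G φ t z *ᵥ v) i := by
      simp only [he, map_sum, map_smul, _root_.sum_apply,
        _root_.smul_apply, smul_eq_mul, Matrix.mulVec, dotProduct, Finset.mul_sum]
      refine Finset.sum_congr rfl fun i _ => Finset.sum_congr rfl fun j _ => ?_
      simp only [G, metricInChart, Matrix.of_apply]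
      rw [F.g_symm t ht]
      ring
    rw [hexp, hGv] at hpos
    simp at hpos

lemma isThreeFormOn_H (hφ : φ ∈ IsManifold.maximalAtlas (𝓡 n) ∞ M) {t : ℝ} (ht : t ∈ I) :
    IsThreeFormOn φ.target (F.H φ t) where
  smooth i j k := by
    have hb : ContDiffOn ℝ ∞ (formInChart φ (F.b t)) φ.target :=
      (F.b_smooth φ hφ).comp (f := fun y => (t, y))
        (contDiff_prodMk_right t).contDiffOn fun y hy => ⟨ht, hy⟩
    have hdb : ContDiffOn ℝ ∞ (extDeriv (formInChart φ (F.b t))) φ.target :=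
      (ContinuousAlternatingMap.alternatizeUncurryFinCLM ℝ (EuclideanSpace ℝ (Fin n)) ℝ
        (n := 2)).contDiff.comp_contDiffOn (hb.fderiv_of_isOpen φ.open_target (by simp))
    exact (ContinuousAlternatingMap.apply ℝ (EuclideanSpace ℝ (Fin n)) ℝ
      ![basisVec i, basisVec j, basisVec k]).contDiff.comp_contDiffOn
        ((F.H₀_smooth φ hφ).add hdb)
  swap_left y i j k := by
    have h := (formInChart φ F.H₀ y + extDeriv (formInChart φ (F.b t)) y).map_swap
      ![basisVec j, basisVec i, basisVec k] (i := 0) (j := 1) (by decide)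
    have e : ![basisVec j, basisVec i, basisVec k] ∘ Equiv.swap (0 : Fin 3) 1
        = ![basisVec i, basisVec j, basisVec k] := by
      ext1 a
      fin_cases a <;> rfl
    rw [e] at h
    exact h
  swap_right y i j k := by
    have h := (formInChart φ F.H₀ y + extDeriv (formInChart φ (F.b t)) y).map_swap
      ![basisVec i, basisVec k, basisVec j] (i := 1) (j := 2) (by decide)
    have e : ![basisVec i, basisVec k, basisVec j] ∘ Equiv.swap (1 : Fin 3) 2
        = ![basisVec i, basisVec j, basisVec k] := by
      ext1 a
      fin_cases a <;> rfl
    rw [e] at h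
    exact h

end MetricFormFamily

end InChart

/-! ### The evolution of the gradient -/

section Evolution

variable {n : ℕ}

lemma contractSharp_eq {G A : Matrix (Fin n) (Fin n) ℝ} (hG : (G⁻¹)ᵀ = G⁻¹) (Y : Fin n → ℝ) :
    contractSharp G A Y = G⁻¹ *ᵥ (Aᵀ *ᵥ Y) := by
  ext k
  simp only [contractSharp, Matrix.mulVec, dotProduct, Matrix.transpose_apply, Finset.mul_sum]
  rw [Finset.sum_comm]
  refine Finset.sum_congr rfl fun j _ => Finset.sum_congr rfl fun i _ => ?_
  have h : G⁻¹ j k = G⁻¹ k j := congrFun (congrFun hG k) j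
  rw [h]
  ring

namespace MetricFormFamily

variable {M : Type*} [TopologicalSpace M] [ChartedSpace (EuclideanSpace ℝ (Fin n)) M]
  {φ : OpenPartialHomeomorph M (EuclideanSpace ℝ (Fin n))} {I : Set ℝ}
  (F : MetricFormFamily n M I)

/-- The evolution of the gradient of a function: `∇_t grad u = grad (∂_t u) -
½ ∂_t (g - b) (grad u, ·)^♯`. -/
lemma nablaT_grad [IsManifold (𝓡 n) ∞ M] (hI : I.OrdConnected) (hI' : I.Nontrivial)
    (hφ : φ ∈ IsManifold.maximalAtlas (𝓡 n) ∞ M) {u : ℝ → M → ℝ}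
    (hu : ContMDiffOn (𝓘(ℝ, ℝ).prod (𝓡 n)) 𝓘(ℝ, ℝ) ∞ (fun p : ℝ × M => u p.1 p.2)
      (I ×ˢ (Set.univ : Set M)))
    {t : ℝ} (ht : t ∈ I) {z : EuclideanSpace ℝ (Fin n)} (hz : z ∈ φ.target) (k : Fin n) :
    F.nablaT φ (F.grad φ u) t z k
      = gradVec (F.G φ t) (fun y => derivWithin (fun s => u s (φ.symm y)) I t) z k
        - contractSharp (F.G φ t z) ((1 / 2 : ℝ) • (F.dtG φ t z - F.dtB φ t z))
            (F.grad φ u t z) k := by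
  have hG := F.isMetricOn_G hφ ht
  have hIu : UniqueDiffOn ℝ I :=
    uniqueDiffOn_convex hI.convex (hI.convex.nontrivial_iff_nonempty_interior.1 hI')
  have hA : ∀ a b, ContDiffOn ℝ ∞ (fun s => F.G φ s z a b) I := fun a b =>
    (F.g_smooth φ hφ a b).comp (f := fun s => (s, z)) (contDiff_prodMk_left z).contDiffOn
      fun s hs => ⟨hs, hz⟩
  have hP := hasDerivWithinAt_inv hIu hA
    (fun s hs => (F.isMetricOn_G hφ hs).isUnit_det z hz) ht
  have hpd := hasDerivWithinAt_pd hI hI' φ.open_target 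
    (w := fun s y => u s (φ.symm y)) (contDiffOn_inChart hφ hu) ht hz
  have hgrad : HasDerivWithinAt (fun s => F.grad φ u s z k) _ I t :=
    HasDerivWithinAt.fun_sum (u := Finset.univ) fun j _ => (hP k j).fun_mul (hpd j)
  have hsymmG : (F.dtG φ t z)ᵀ = F.dtG φ t z := by
    ext a b
    refine derivWithin_congr (fun s hs => ?_) ?_
    · exact F.g_symm s hs _ _ _
    · exact F.g_symm t ht _ _ _
  have hPα : F.grad φ u t z = (F.G φ t z)⁻¹ *ᵥ fun j => pd j (fun y => u t (φ.symm y)) z := rfl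
  have e1 : ∑ j, (-((F.G φ t z)⁻¹ * F.dtG φ t z * (F.G φ t z)⁻¹)) k j
      * pd j (fun y => u t (φ.symm y)) z
      = -((F.G φ t z)⁻¹ *ᵥ (F.dtG φ t z *ᵥ F.grad φ u t z)) k := by
    rw [hPα, Matrix.mulVec_mulVec, Matrix.mulVec_mulVec, Matrix.mul_assoc]
    simp only [Matrix.neg_apply, neg_mul, Finset.sum_neg_distrib]
    rfl
  rw [nablaT, hgrad.derivWithin (hIu t ht), Finset.sum_add_distrib, gradVec]
  rw [contractSharp_eq (hG.inv_symm hz), contractSharp_eq (hG.inv_symm hz)]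
  change ∑ j, (-((F.G φ t z)⁻¹ * F.dtG φ t z * (F.G φ t z)⁻¹)) k j
      * pd j (fun y => u t (φ.symm y)) z + _ + _ = _
  rw [e1]
  simp only [Matrix.transpose_smul, Matrix.transpose_add, Matrix.transpose_sub, hsymmG,
    Matrix.smul_mulVec, Matrix.add_mulVec, Matrix.sub_mulVec, Matrix.mulVec_smul,
    Matrix.mulVec_add, Matrix.mulVec_sub, Pi.smul_apply, Pi.add_apply, Pi.sub_apply, smul_eq_mul]
  ring

/-- For a solution `u` of the heat equation, `∇_t grad u = Δ grad u -
(Rc^∇ + ½ ∂_t (g - b)) (grad u, ·)^♯`. -/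
theorem nablaT_grad_of_solvesHeat [IsManifold (𝓡 n) ∞ M] (hI : I.OrdConnected)
    (hI' : I.Nontrivial) (hφ : φ ∈ IsManifold.maximalAtlas (𝓡 n) ∞ M) {u : ℝ → M → ℝ}
    (hu : ContMDiffOn (𝓘(ℝ, ℝ).prod (𝓡 n)) 𝓘(ℝ, ℝ) ∞ (fun p : ℝ × M => u p.1 p.2)
      (I ×ˢ (Set.univ : Set M))) (hheat : F.SolvesHeat u)
    {t : ℝ} (ht : t ∈ I) {z : EuclideanSpace ℝ (Fin n)} (hz : z ∈ φ.target) (k : Fin n) :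
    F.nablaT φ (F.grad φ u) t z k
      = lapVec (F.G φ t) (F.Γ φ t) (F.grad φ u t) z k
        - contractSharp (F.G φ t z)
            (F.ricciBismut φ t z + (1 / 2 : ℝ) • (F.dtG φ t z - F.dtB φ t z))
            (F.grad φ u t z) k := by
  have hG := F.isMetricOn_G hφ ht
  have hf : ContDiffOn ℝ ∞ (fun y => u t (φ.symm y)) φ.target :=
    (contDiffOn_inChart hφ hu).comp (f := fun y => (t, y))
      (contDiff_prodMk_right t).contDiffOn fun y hy => ⟨ht, hy⟩
  have hheat' : gradVec (F.G φ t) (fun y => derivWithin (fun s => u s (φ.symm y)) I t) z k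
      = gradVec (F.G φ t) (lapFun (F.G φ t) (bismut (F.G φ t) (F.H φ t))
          fun y => u t (φ.symm y)) z k :=
    Finset.sum_congr rfl fun j _ => by
      rw [pd_congr φ.open_target (fun y hy => hheat φ hφ t ht y hy) hz]
      rfl
  rw [F.nablaT_grad hI hI' hφ hu ht hz, hheat',
    gradVec_lapFun_bismut hG (F.isThreeFormOn_H hφ ht) hf hz k]
  simp only [contractSharp_eq (hG.inv_symm hz), Matrix.transpose_add, Matrix.add_mulVec,
    Matrix.mulVec_add, Pi.add_apply]
  rw [sub_sub]
  rfl

/-- Along generalized Ricci flow `½ ∂_t (g - b) = -Rc + ¼ H² + ½ d^* H`, which is `-Rc^∇`. -/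
theorem ricciBismut_add_half_dt_eq_zero [IsManifold (𝓡 n) ∞ M]
    (hφ : φ ∈ IsManifold.maximalAtlas (𝓡 n) ∞ M) (hflow : F.IsGeneralizedRicciFlow)
    {t : ℝ} (ht : t ∈ I) {z : EuclideanSpace ℝ (Fin n)} (hz : z ∈ φ.target) :
    F.ricciBismut φ t z + (1 / 2 : ℝ) • (F.dtG φ t z - F.dtB φ t z) = 0 := by
  ext i j
  have hric : F.ricciBismut φ t z i j = _ :=
    ricci_bismut (F.isMetricOn_G hφ ht) (F.isThreeFormOn_H hφ ht) hz i j
  obtain ⟨hg, hb⟩ := hflow φ hφ t ht z hz i j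
  simp only [Matrix.add_apply, Matrix.smul_apply, Matrix.sub_apply, hric, hg, hb, smul_eq_mul,
    Matrix.zero_apply]
  ring

end MetricFormFamily

end Evolution

end GenRicci

end

theorem proposition3p4 {n : ℕ} {M : Type*} [TopologicalSpace M]
    [ChartedSpace (EuclideanSpace ℝ (Fin n)) M] [IsManifold (𝓡 n) ∞ M]
    {I : Set ℝ} (hI : I.OrdConnected) (hI' : I.Nontrivial)
    (F : GenRicci.MetricFormFamily n M I) (u : ℝ → M → ℝ)
    (hu : ContMDiffOn (𝓘(ℝ, ℝ).prod (𝓡 n)) 𝓘(ℝ, ℝ) ∞ (fun p : ℝ × M => u p.1 p.2)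
      (I ×ˢ (Set.univ : Set M)))
    (hheat : F.SolvesHeat u) :
    (∀ φ ∈ IsManifold.maximalAtlas (𝓡 n) ∞ M, ∀ t ∈ I, ∀ z ∈ φ.target, ∀ k : Fin n,
      F.nablaT φ (F.grad φ u) t z k
        = GenRicci.lapVec (F.G φ t) (F.Γ φ t) (F.grad φ u t) z k
          - GenRicci.contractSharp (F.G φ t z)
              (F.ricciBismut φ t z + (1 / 2 : ℝ) • (F.dtG φ t z - F.dtB φ t z))
              (F.grad φ u t z) k) ∧
    (F.IsGeneralizedRicciFlow →
      ∀ φ ∈ IsManifold.maximalAtlas (𝓡 n) ∞ M, ∀ t ∈ I, ∀ z ∈ φ.target, ∀ k : Fin n,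
        F.nablaT φ (F.grad φ u) t z k
          = GenRicci.lapVec (F.G φ t) (F.Γ φ t) (F.grad φ u t) z k) := by
  have main := fun φ hφ t ht z hz k =>
    F.nablaT_grad_of_solvesHeat (φ := φ) hI hI' hφ hu hheat (t := t) ht (z := z) hz k
  refine ⟨main, fun hflow φ hφ t ht z hz k => ?_⟩
  rw [main φ hφ t ht z hz k, F.ricciBismut_add_half_dt_eq_zero hφ hflow ht hz]
  simp [GenRicci.contractSharp]
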